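/- For a group $G$ let $\gamma_1(G)=G$, $\gamma_{i+1}(G)=[\gamma_i(G),G]$, $G'=\gamma_2(G)$, $G_{ab}=G/G'$. For finitely generated residually nilpotent groups $G,H$ (residually nilpotent means $\bigcap_i\gamma_i=1$), $H$ is called para-$G$ if there is a monomorphism $\phi:G\to H$ which induces isomorphisms $G/\gamma_i(G)\cong H/\gamma_i(H)$ for all $i\ge 1$. If $\theta$ is an automorphism of a group $X$, let $X\rtimes_\theta T$ be the semidirect product in which $T=\langle t\rangle$ is infinite cyclic and $t$ acts on $X$ by $\theta$; we write $\theta$ also for its restriction to a subgroup $Y\le X$ with $\theta(Y)=Y$. Theorem 3.8. Let $N$ be a finitely generated free nilpotent group of class $2$, that is, $N\cong F/\gamma_3(F)$ for a free group $F$ of finite rank. Let $p$ be a prime and let $\mu\in\operatorname{Aut}(N_{ab})$ have order $p$ and be fixed-point-free (no $x\ne 1$ satisfies $\mu(x)=x$), and suppose that $N_{ab}=\langle \mu^i(a)\mid 0\le i\le p-2\rangle$ for some $a\in N_{ab}$. Then $\mu$ lifts to an automorphism of $N$. Moreover, let $\alpha\in\operatorname{Aut}(N)$ be any lift of $\mu$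 and put $H=N\rtimes_\alpha T$ and $\tilde H=N_{ab}\rtimes_\mu T$. Let $A\le N_{ab}$ satisfy $\mu(A)=A$ (equivalently $A\lhd\tilde H$) and $N_{ab}^m\le A$ for some $m\in\mathbb N$ prime to $p$, and put $\tilde G=A\rtimes_\mu T$. Let $M\le N$ satisfy $\alpha(M)=M$ (which holds in particular if $M\lhd H$), $M\cap N'=M'$ and $MN'/N'=A$, and put $G=M\rtimes_\alpha T$. Then $G$ and $H$ are finitely generated and residually nilpotent, and $H$ is para-$G$. Furthermore, if $\tilde G\not\cong\tilde H$, then $G\not\cong H$. -/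

import Mathlib

universe u v

/-- `N` is a finitely generated free nilpotent group of class `2`: it is isomorphic to `F / γ₃(F)`
for a free group `F` of finite rank. (Mathlib numbers the lower central series from `0`, so that
its term of index `2` is `γ₃`.) -/
def IsFGFreeNilpotentTwo (N : Type u) [Group N] : Prop :=
  ∃ r : ℕ, Nonempty
    (N ≃* FreeGroup (Fin r) ⧸ (⊤ : Subgroup (FreeGroup (Fin r))).lowerCentralSeries 2)

/-- A group is residually nilpotent if its lower central series intersects in the identity. -/
def IsResiduallyNilpotent (G : Type u) [Group G] : Prop :=
  ⨅ i : ℕ, (⊤ : Subgroup G).lowerCentralSeries i = ⊥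

/-- A homomorphism maps every term of the lower central series into the corresponding term. -/
theorem lowerCentralSeries_le_comap_hom {G : Type u} {H : Type v} [Group G] [Group H]
    (φ : G →* H) (i : ℕ) :
    (⊤ : Subgroup G).lowerCentralSeries i ≤
      ((⊤ : Subgroup H).lowerCentralSeries i).comap φ := by
  rw [← Subgroup.map_le_iff_le_comap]
  induction i with
  | zero => exact le_top
  | succ i ih =>
    rw [Subgroup.lowerCentralSeries_succ, Subgroup.lowerCentralSeries_succ,
      Subgroup.map_commutator]
    exact Subgroup.commutator_mono ih le_top

/-- The homomorphism `G / γᵢ(G) → H / γᵢ(H)` induced by `φ : G → H`. -/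
def lowerCentralQuotientMap {G : Type u} {H : Type v} [Group G] [Group H] (φ : G →* H) (i : ℕ) :
    G ⧸ (⊤ : Subgroup G).lowerCentralSeries i →* H ⧸ (⊤ : Subgroup H).lowerCentralSeries i :=
  QuotientGroup.map _ _ φ (lowerCentralSeries_le_comap_hom φ i)

/-- `H` is para-`G`: both groups are finitely generated and residually nilpotent, and there is a
monomorphism `φ : G → H` inducing isomorphisms `G / γᵢ(G) ≅ H / γᵢ(H)` for all `i`. -/
def IsPara (G : Type u) (H : Type v) [Group G] [Group H] : Prop :=
  (Group.FG G ∧ IsResiduallyNilpotent G) ∧ (Group.FG H ∧ IsResiduallyNilpotent H) ∧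
    ∃ φ : G →* H, Function.Injective φ ∧
      ∀ i : ℕ, Function.Bijective (lowerCentralQuotientMap φ i)

/-- The semidirect product `N ⋊ T`, where `T` is the infinite cyclic group on a generator `t`
acting on `N` by the automorphism `α`. -/
abbrev CyclicExtension {N : Type u} [Group N] (α : MulAut N) : Type u :=
  N ⋊[zpowersHom (MulAut N) α] Multiplicative ℤ

/-- The automorphism of the subgroup `M` obtained by restricting an automorphism `α` with
`α(M) = M`. -/
def restrictAut {N : Type u} [Group N] (α : MulAut N) (M : Subgroup N)
    (hM : M.map (MulEquiv.toMonoidHom α) = M) : MulAut M :=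
  (MulEquiv.subgroupMap α M).trans (MulEquiv.subgroupCongr hM)

-- Everything rests on a trace argument. Since μ is fixed-point-free with μ^p = 1, the product
-- x·μ(x)⋯μ^(p-1)(x) is fixed by μ, hence trivial. In the abelianization of X ⋊ T, for X = M or N,
-- all αⁱ(x) agree, so x^p lies in the derived subgroup (`inl_pow_mem_commutator`). Commutator
-- calculus then gives exponent p for all lower central factors from the second on, and x^(p^i) ∈
-- γ_(i+1).
--
-- Para: every x has x^(m³) ∈ M. For n a multiple of m³ with n ≡ 1 modulo a high power of p, the map
-- x ↦ xⁿ sends N into M and is the identity modulo γ_i, whence surjectivity. Composed with M →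
-- G/γ_i(G) this power map is even a homomorphism, because the class-two correction [y,x]^(n choose
-- 2) dies. It therefore extends to H → G/γ_i(G), which forces γ_i(H) ∩ G ≤ γ_i(G)
-- (`exists_extension`).
--
-- Residual nilpotence: (μ-1)^p is divisible by p, so μ is unipotent modulo p^k on N/N', and α
-- likewise on N'. Hence some γ_i(H) lies in the subgroup of products y^(p^(k+1)) z^(p^k) with z ∈
-- N'. These subgroups intersect trivially over k, since N/N' and N' embed in free abelian groups.
--
-- Non-isomorphism: the base group consists of the h with h^p in the derived subgroup, so an
-- isomorphism G ≅ H maps M onto N and M' onto N'. Dividing these out, and using M ∩ N' = M', gives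
-- an isomorphism of the two metabelian extensions.

universe w

open scoped commutatorElement

open SemidirectProduct

/-! ### Commutator calculus in class at most two -/

namespace ClassTwo

variable {N : Type*} [Group N]

theorem commute (hc : commutator N ≤ Subgroup.center N) {z : N} (hz : z ∈ commutator N) (g : N) :
    Commute z g :=
  (Subgroup.mem_center_iff.1 (hc hz) g).symm

theorem commutator_mem (x y : N) : ⁅x, y⁆ ∈ commutator N :=
  Subgroup.commutator_mem_commutator (Subgroup.mem_top _) (Subgroup.mem_top _)

theorem commutatorElement_mul_left (hc : commutator N ≤ Subgroup.center N) (x y z : N) :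
    ⁅x * y, z⁆ = ⁅x, z⁆ * ⁅y, z⁆ := by
  have h := (commute hc (commutator_mem y z) x).eq
  calc ⁅x * y, z⁆ = x * ⁅y, z⁆ * (z * x⁻¹ * z⁻¹) := by
        simp only [commutatorElement_def]; group
    _ = ⁅y, z⁆ * ⁅x, z⁆ := by rw [← h]; simp only [commutatorElement_def]; group
    _ = _ := (commute hc (commutator_mem y z) _).eq

theorem commutatorElement_mul_right (hc : commutator N ≤ Subgroup.center N) (x y z : N) :
    ⁅x, y * z⁆ = ⁅x, y⁆ * ⁅x, z⁆ := by
  rw [← commutatorElement_inv, commutatorElement_mul_left hc, mul_inv_rev, commutatorElement_inv,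
    commutatorElement_inv, (commute hc (commutator_mem x z) _).eq]

theorem commutatorElement_of_mem_left (hc : commutator N ≤ Subgroup.center N) {z : N}
    (hz : z ∈ commutator N) (x : N) : ⁅z, x⁆ = 1 :=
  commutatorElement_eq_one_iff_commute.2 (commute hc hz x)

/-- The homomorphism `x ↦ ⁅x, y⁆` of a group of class at most two. -/
def commutatorHom (hc : commutator N ≤ Subgroup.center N) (y : N) : N →* N :=
  MonoidHom.mk' (fun x => ⁅x, y⁆) fun a b => commutatorElement_mul_left hc a b y

theorem commutatorElement_pow_left (hc : commutator N ≤ Subgroup.center N) (x y : N) (n : ℕ) :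
    ⁅x ^ n, y⁆ = ⁅x, y⁆ ^ n :=
  map_pow (commutatorHom hc y) x n

theorem commutatorElement_pow_right (hc : commutator N ≤ Subgroup.center N) (x y : N) (n : ℕ) :
    ⁅x, y ^ n⁆ = ⁅x, y⁆ ^ n := by
  rw [← commutatorElement_inv, commutatorElement_pow_left hc, ← inv_pow, commutatorElement_inv]

theorem commutatorElement_pow_pow (hc : commutator N ≤ Subgroup.center N) (x y : N) (n : ℕ) :
    ⁅x ^ n, y ^ n⁆ = ⁅x, y⁆ ^ (n * n) := by
  rw [commutatorElement_pow_left hc, commutatorElement_pow_right hc, pow_mul]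

theorem pow_mul_eq (hc : commutator N ≤ Subgroup.center N) (x y : N) (n : ℕ) :
    y ^ n * x = x * y ^ n * ⁅y, x⁆ ^ n := by
  rw [← commutatorElement_pow_left hc, ← (commute hc (commutator_mem (y ^ n) x) _).eq]
  simp only [commutatorElement_def]; group

/-- Moving the next x past yⁿ costs the central factor [y,x]ⁿ, and 0 + 1 + ⋯ + (n-1) is the binomial
coefficient. -/
theorem mul_pow_eq (hc : commutator N ≤ Subgroup.center N) (x y : N) (n : ℕ) :
    (x * y) ^ n = x ^ n * y ^ n * ⁅y, x⁆ ^ n.choose 2 := by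
  induction n with
  | zero => simp
  | succ n ih =>
    have h1 : ∀ g : N, ∀ k, ⁅y, x⁆ ^ k * g = g * ⁅y, x⁆ ^ k := fun g k =>
      ((commute hc (commutator_mem y x) g).pow_left k).eq
    have h2 : (n + 1).choose 2 = n + n.choose 2 := by
      rw [Nat.choose_succ_succ' n 1, Nat.choose_one_right]
    have h3 := pow_mul_eq hc x y n
    generalize ⁅y, x⁆ = c at *
    calc (x * y) ^ (n + 1) = x ^ n * y ^ n * (c ^ n.choose 2 * (x * y)) := by
          rw [pow_succ, ih, mul_assoc]
      _ = x ^ n * (y ^ n * x) * y * c ^ n.choose 2 := by rw [h1]; simp only [mul_assoc]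
      _ = x ^ n * x * y ^ n * (c ^ n * y) * c ^ n.choose 2 := by rw [h3]; simp only [mul_assoc]
      _ = x ^ (n + 1) * y ^ (n + 1) * c ^ (n + 1).choose 2 := by
          rw [h1, h2, pow_add c, pow_succ x, pow_succ y]; simp only [mul_assoc]

/-- In a group of class at most two, `M ≤ K N'` implies `M' ≤ K'`. -/
theorem commutator_le_commutator_of_le_sup (hc : commutator N ≤ Subgroup.center N)
    {M K : Subgroup N} (h : M ≤ K ⊔ commutator N) : ⁅M, M⁆ ≤ ⁅K, K⁆ := by
  rw [Subgroup.commutator_le]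
  intro a ha b hb
  obtain ⟨a₁, ha₁, a₂, ha₂, rfl⟩ := Subgroup.mem_sup_of_normal_right.1 (h ha)
  obtain ⟨b₁, hb₁, b₂, hb₂, rfl⟩ := Subgroup.mem_sup_of_normal_right.1 (h hb)
  have h1 : ⁅a₁, b₂⁆ = 1 := by
    rw [← commutatorElement_inv, commutatorElement_of_mem_left hc hb₂, inv_one]
  rw [commutatorElement_mul_left hc, commutatorElement_mul_right hc,
    commutatorElement_of_mem_left hc ha₂, h1, mul_one, mul_one]
  exact Subgroup.commutator_mem_commutator ha₁ hb₁

/-- An endomorphism of a group of class at most two inducing the identity on the abelianization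
fixes the derived subgroup. -/
theorem map_eq_self_of_mem_commutator (hc : commutator N ≤ Subgroup.center N) (f : N →* N)
    (hf : ∀ x, f x * x⁻¹ ∈ commutator N) {z : N} (hz : z ∈ commutator N) : f z = z := by
  have key : commutator N ≤ f.eqLocus (MonoidHom.id N) := by
    rw [commutator_def, Subgroup.commutator_le]
    intro a _ b _
    have ha : f a = f a * a⁻¹ * a := by group
    have hb : f b = f b * b⁻¹ * b := by group
    have h1 : ⁅a, f b * b⁻¹⁆ = 1 := by
      rw [← commutatorElement_inv, commutatorElement_of_mem_left hc (hf b), inv_one]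
    show f ⁅a, b⁆ = ⁅a, b⁆
    rw [map_commutatorElement, ha, commutatorElement_mul_left hc,
      commutatorElement_of_mem_left hc (hf a), one_mul, hb, commutatorElement_mul_right hc, h1,
      one_mul]
  exact key hz

/-- The kernel lies in N', where f is the identity; and x differs from f x by an element of N',
which f fixes. -/
theorem bijective_of_mul_inv_mem (hc : commutator N ≤ Subgroup.center N) (f : N →* N)
    (hf : ∀ x, f x * x⁻¹ ∈ commutator N) : Function.Bijective f := by
  constructor
  · rw [injective_iff_map_eq_one]
    intro x hx
    have h := hf x
    rw [hx, one_mul, inv_mem_iff] at h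
    rw [← map_eq_self_of_mem_commutator hc f hf h, hx]
  · intro x
    refine ⟨(f x * x⁻¹)⁻¹ * x, ?_⟩
    rw [map_mul, map_eq_self_of_mem_commutator hc f hf (inv_mem (hf x))]
    group

end ClassTwo

/-! ### Abelianizations and equivariant maps -/

theorem Abelianization.of_eq_one_iff {N : Type*} [Group N] {x : N} :
    Abelianization.of x = 1 ↔ x ∈ commutator N := by
  rw [← MonoidHom.mem_ker, Abelianization.ker_of]

theorem Abelianization.of_eq_of_iff {N : Type*} [Group N] {x y : N} :
    Abelianization.of x = Abelianization.of y ↔ x * y⁻¹ ∈ commutator N := by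
  rw [← Abelianization.of_eq_one_iff, map_mul, map_inv, mul_inv_eq_one]

theorem Abelianization.of_surjective {N : Type*} [Group N] :
    Function.Surjective (Abelianization.of : N →* Abelianization N) :=
  QuotientGroup.mk_surjective

theorem MulAut.zpow_intertwines {X Y : Type*} [Group X] [Group Y] {β : MulAut X} {γ : MulAut Y}
    {f : X →* Y} (h : ∀ x, f (β x) = γ (f x)) (k : ℤ) (x : X) : f ((β ^ k) x) = (γ ^ k) (f x) := by
  have hinv : ∀ x, f (β⁻¹ x) = γ⁻¹ (f x) := fun x => by
    have h1 := h (β⁻¹ x)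
    rw [MulAut.apply_inv_self] at h1
    rw [h1, MulAut.inv_apply_self]
  induction k generalizing x with
  | zero => simp
  | succ i ih => rw [zpow_add_one, zpow_add_one, MulAut.mul_apply, MulAut.mul_apply, ih, h]
  | pred i ih => rw [zpow_sub_one, zpow_sub_one, MulAut.mul_apply, MulAut.mul_apply, ih, hinv]

/-! ### Cyclic extensions: generation, functoriality, universal property -/

namespace CyclicExtension

variable {X : Type*} [Group X] {Y : Type*} [Group Y] {β : MulAut X} {γ : MulAut Y}

/-- The generator of the infinite cyclic factor. -/
def gen (β : MulAut X) : CyclicExtension β := inr (Multiplicative.ofAdd 1)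

theorem inr_eq_zpow (b : Multiplicative ℤ) :
    (inr b : CyclicExtension β) = gen β ^ Multiplicative.toAdd b := by
  rw [gen, ← map_zpow, ← ofAdd_zsmul]
  simp

theorem inl_apply (x : X) :
    (inl (β x) : CyclicExtension β) = gen β * inl x * (gen β)⁻¹ := by
  have := inl_aut (φ := zpowersHom (MulAut X) β) (Multiplicative.ofAdd 1) x
  rw [map_inv] at this
  simpa [gen] using this

/-- Serves as an induction principle: a property cut out by a subgroup (centralizer, normalizer,
equalizer) need only be tested on X and on t. -/
theorem eq_top_of_le {S : Subgroup (CyclicExtension β)} (hl : ∀ x, inl x ∈ S)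
    (ht : gen β ∈ S) : S = ⊤ := by
  refine (Subgroup.eq_top_iff' S).2 fun h => ?_
  rw [← inl_left_mul_inr_right h, inr_eq_zpow]
  exact mul_mem (hl _) (zpow_mem ht _)

/-- The homomorphism between cyclic extensions induced by an equivariant homomorphism. -/
def mapHom (f : X →* Y) (h : ∀ x, f (β x) = γ (f x)) : CyclicExtension β →* CyclicExtension γ :=
  SemidirectProduct.map f (MonoidHom.id _) fun b => by
    ext x
    simpa [zpowersHom_apply] using MulAut.zpow_intertwines h _ x

theorem mapHom_inl (f : X →* Y) (h : ∀ x, f (β x) = γ (f x)) (x : X) :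
    mapHom f h (inl x) = inl (f x) :=
  SemidirectProduct.map_inl _ _ _ _

theorem mapHom_gen (f : X →* Y) (h : ∀ x, f (β x) = γ (f x)) :
    mapHom f h (gen β) = gen γ :=
  SemidirectProduct.map_inr _ _ _ _

theorem mapHom_injective {f : X →* Y} (h : ∀ x, f (β x) = γ (f x))
    (hf : Function.Injective f) : Function.Injective (mapHom f h) := by
  intro a b hab
  ext
  · exact hf (congrArg SemidirectProduct.left hab)
  · exact congrArg (fun x : CyclicExtension γ => x.right.toAdd) hab

theorem mapHom_surjective {f : X →* Y} (h : ∀ x, f (β x) = γ (f x))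
    (hf : Function.Surjective f) : Function.Surjective (mapHom f h) := by
  intro b
  obtain ⟨x, hx⟩ := hf b.left
  exact ⟨⟨x, b.right⟩, SemidirectProduct.ext hx rfl⟩

theorem mem_ker_mapHom_iff {f : X →* Y} (h : ∀ x, f (β x) = γ (f x)) (g : CyclicExtension β) :
    g ∈ (mapHom f h).ker ↔ ∃ x ∈ f.ker, inl x = g := by
  constructor
  · intro hg
    have h1 : f g.left = 1 := congrArg SemidirectProduct.left hg
    have h2 : g.right = 1 := congrArg SemidirectProduct.right hg
    exact ⟨g.left, h1, SemidirectProduct.ext rfl h2.symm⟩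
  · rintro ⟨x, hx, rfl⟩
    rw [MonoidHom.mem_ker, mapHom_inl, MonoidHom.mem_ker.1 hx, map_one]

/-- The homomorphism out of a cyclic extension determined by its values on the two factors. -/
def liftHom {Q : Type*} [Group Q] (f : X →* Q) (q : Q) (h : ∀ x, f (β x) = q * f x * q⁻¹) :
    CyclicExtension β →* Q :=
  SemidirectProduct.lift f (zpowersHom Q q) fun b => by
    ext x
    have := MulAut.zpow_intertwines (γ := MulAut.conj q) (f := f) (β := β) (by simpa using h)
      (Multiplicative.toAdd b) x
    rw [← map_zpow] at this
    simpa [zpowersHom_apply] using this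

theorem liftHom_inl {Q : Type*} [Group Q] (f : X →* Q) (q : Q)
    (h : ∀ x, f (β x) = q * f x * q⁻¹) (x : X) : liftHom f q h (inl x) = f x :=
  SemidirectProduct.lift_inl _ _ _ _

theorem liftHom_gen {Q : Type*} [Group Q] (f : X →* Q) (q : Q)
    (h : ∀ x, f (β x) = q * f x * q⁻¹) : liftHom f q h (gen β) = q := by
  rw [liftHom, gen, SemidirectProduct.lift_inr]
  simp

theorem fg (hX : Group.FG X) : Group.FG (CyclicExtension β) := by
  obtain ⟨S, hS, hfin⟩ := Group.fg_iff.1 hX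
  refine Group.fg_iff.2 ⟨insert (gen β) (inl '' S), ?_, (hfin.image _).insert _⟩
  refine eq_top_of_le (fun x => ?_) (Subgroup.subset_closure (Set.mem_insert _ _))
  have hx : (inl x : CyclicExtension β) ∈ (Subgroup.closure S).map inl :=
    ⟨x, by rw [hS]; trivial, rfl⟩
  rw [MonoidHom.map_closure] at hx
  exact Subgroup.closure_mono (Set.subset_insert _ _) hx

theorem commutator_le_range_inl : commutator (CyclicExtension β) ≤ (inl : X →* _).range := by
  rw [range_inl_eq_ker_rightHom]
  exact Abelianization.commutator_subset_ker _

end CyclicExtension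

/-! ### Traces, and exponents of lower central factors -/

/-- If `f` is invariant under `β`, it maps `x · β x ⋯ β^(k-1) x` to `f(x)^k`. -/
theorem MulAut.exists_trace {X : Type*} [Group X] (β : MulAut X) {Q : Type*} [Group Q]
    (f : X →* Q) (hf : ∀ x, f (β x) = f x) {L : Type*} [CommGroup L] (μ : MulAut L) (g : X →* L)
    (hg : ∀ x, g (β x) = μ (g x)) (x : X) (k : ℕ) :
    ∃ w : X, f w = f x ^ k ∧ g w = ∏ i ∈ Finset.range k, (μ ^ i) (g x) := by
  induction k with
  | zero => exact ⟨1, by simp, by simp⟩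
  | succ k ih =>
    obtain ⟨w, h1, h2⟩ := ih
    have h3 : f ((β ^ k) x) = f x := by
      have := MulAut.zpow_intertwines (γ := 1) (f := f) (β := β) (by simpa using hf) k x
      simpa using this
    have h4 : g ((β ^ k) x) = (μ ^ k) (g x) := by
      simpa using MulAut.zpow_intertwines hg k x
    exact ⟨w * (β ^ k) x, by rw [map_mul, h1, h3, pow_succ],
      by rw [map_mul, h2, h4, Finset.prod_range_succ]⟩

/-- The trace of a fixed-point-free automorphism of finite order vanishes. -/
theorem MulAut.prod_pow_apply_eq_one {L : Type*} [CommGroup L] {μ : MulAut L} {p : ℕ}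
    (hμ : μ ^ p = 1) (hfpf : ∀ x, μ x = x → x = 1) (x : L) :
    ∏ i ∈ Finset.range p, (μ ^ i) x = 1 := by
  -- μ permutes the factors of the trace cyclically, as μ^p = 1, so the trace is a fixed point.
  apply hfpf
  rw [map_prod]
  have h1 : ∀ i, μ ((μ ^ i) x) = (μ ^ (i + 1)) x := fun i => by
    rw [pow_succ', MulAut.mul_apply]
  simp only [h1]
  have h2 := Finset.prod_range_succ (fun i => (μ ^ i) x) p
  rw [Finset.prod_range_succ'] at h2
  simpa [hμ] using h2

theorem commutatorElement_pow_left_of_commute {Q : Type*} [Group Q] {x g : Q}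
    (h : Commute x ⁅x, g⁆) (n : ℕ) : ⁅x ^ n, g⁆ = ⁅x, g⁆ ^ n := by
  induction n with
  | zero => simp
  | succ n ih =>
    rw [pow_succ, commutatorElement_mul_left_eq_conj_mul, (h.pow_left n).eq,
      mul_inv_cancel_right, ih, pow_succ']

/-- The image of `γ_{i+1}` modulo `γ_{i+2}` is central. -/
theorem map_lowerCentralSeries_le_center {G : Type*} [Group G] (i : ℕ) :
    ((⊤ : Subgroup G).lowerCentralSeries i).map
      (QuotientGroup.mk' ((⊤ : Subgroup G).lowerCentralSeries (i + 1))) ≤ Subgroup.center _ := by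
  rw [← Subgroup.commutator_top_right_eq_bot_iff_le_center,
    ← MonoidHom.range_eq_top.2 (QuotientGroup.mk'_surjective _), MonoidHom.range_eq_map,
    ← Subgroup.map_commutator, ← Subgroup.lowerCentralSeries_succ, QuotientGroup.map_mk'_self]

/-- If `p`-th powers of elements of `γ_{i+1}` are central modulo `γ_{i+3}`, then
`p`-th powers of elements of `γ_{i+2}` lie in `γ_{i+3}`. -/
theorem pow_mem_lowerCentralSeries_of_center {G : Type*} [Group G] {p i : ℕ}
    (H : ∀ x ∈ (⊤ : Subgroup G).lowerCentralSeries i,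
      QuotientGroup.mk' ((⊤ : Subgroup G).lowerCentralSeries (i + 2)) x ^ p ∈ Subgroup.center _)
    {h : G} (hh : h ∈ (⊤ : Subgroup G).lowerCentralSeries (i + 1)) :
    h ^ p ∈ (⊤ : Subgroup G).lowerCentralSeries (i + 2) := by
  let q := QuotientGroup.mk' ((⊤ : Subgroup G).lowerCentralSeries (i + 2))
  -- Central elements killed by p form a subgroup, so only the generating commutators need testing.
  -- There [x,g] is central, whence [x,g]^p = [x^p,g] = 1.
  let K : Subgroup (G ⧸ (⊤ : Subgroup G).lowerCentralSeries (i + 2)) :=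
    { carrier := {c | c ∈ Subgroup.center _ ∧ c ^ p = 1}
      one_mem' := ⟨one_mem _, one_pow p⟩
      mul_mem' := fun {a b} ha hb => ⟨mul_mem ha.1 hb.1, by
        rw [Commute.mul_pow (Subgroup.mem_center_iff.1 hb.1 a), ha.2, hb.2, one_mul]⟩
      inv_mem' := fun {a} ha => ⟨inv_mem ha.1, by rw [inv_pow, ha.2, inv_one]⟩ }
  have key : (⊤ : Subgroup G).lowerCentralSeries (i + 1) ≤ K.comap q := by
    rw [Subgroup.lowerCentralSeries_succ, Subgroup.commutator_le]
    intro x hx g _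
    have hc : q ⁅x, g⁆ ∈ Subgroup.center _ := map_lowerCentralSeries_le_center (i + 1)
      (Subgroup.mem_map_of_mem _ (Subgroup.commutator_mem_commutator hx (Subgroup.mem_top g)))
    refine ⟨hc, ?_⟩
    rw [map_commutatorElement] at hc ⊢
    rw [← commutatorElement_pow_left_of_commute (Subgroup.mem_center_iff.1 hc _),
      commutatorElement_eq_one_iff_mul_comm]
    exact (Subgroup.mem_center_iff.1 (H x hx) _).symm
  rw [← QuotientGroup.eq_one_iff, QuotientGroup.mk_pow]
  exact (key hh).2

/-! ### p-th powers of base elements; recovering the base group -/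

namespace CyclicExtension

variable {X : Type*} [Group X] {Y : Type*} [Group Y] {β : MulAut X} {γ : MulAut Y} {p : ℕ}

/-- If `β` lifts a fixed-point-free automorphism of order dividing `p` of `X / X'`, then
`p`-th powers of elements of `X` lie in the derived subgroup of the cyclic extension. -/
theorem inl_pow_mem_commutator {L : Type*} [CommGroup L] {μ : MulAut L} (hμ : μ ^ p = 1)
    (hfpf : ∀ x, μ x = x → x = 1) (g : X →* L) (hg : ∀ x, g (β x) = μ (g x))
    (hker : g.ker ≤ commutator X) (x : X) :
    (inl x : CyclicExtension β) ^ p ∈ commutator (CyclicExtension β) := by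
  -- Conjugation by t is invisible in the abelianization, so f is β-invariant: the trace of x maps
  -- to f(x)^p, yet lies in X'.
  let f : X →* Abelianization (CyclicExtension β) := Abelianization.of.comp inl
  have hf : ∀ x, f (β x) = f x := fun x => by
    simp only [f, MonoidHom.comp_apply, inl_apply, map_mul, map_inv]
    exact mul_inv_cancel_comm _ _
  obtain ⟨w, h1, h2⟩ := MulAut.exists_trace β f hf μ g hg x p
  rw [MulAut.prod_pow_apply_eq_one hμ hfpf] at h2
  have h3 : f w = 1 := Abelianization.commutator_subset_ker f (hker h2)
  rw [← Abelianization.of_eq_one_iff, map_pow]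
  exact h1.symm.trans h3

/-- Characterizes the base group inside the abstract group: the quotient by it is abelian and
torsion-free. -/
theorem pow_mem_commutator_iff (hp : p ≠ 0)
    (hβ : ∀ x, (inl x : CyclicExtension β) ^ p ∈ commutator (CyclicExtension β))
    (h : CyclicExtension β) :
    h ^ p ∈ commutator (CyclicExtension β) ↔ h ∈ (inl : X →* CyclicExtension β).range := by
  constructor
  · intro hh
    have h1 := commutator_le_range_inl hh
    rw [range_inl_eq_ker_rightHom, MonoidHom.mem_ker] at h1 ⊢
    rw [map_pow] at h1
    exact (pow_eq_one_iff_left hp).1 h1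
  · rintro ⟨x, rfl⟩
    exact hβ x

/-- In a central quotient of class two, `p`-th powers are central. -/
theorem pow_mem_center_of_class_two {Q : Type*} [Group Q]
    (hβ : ∀ x, (inl x : CyclicExtension β) ^ p ∈ commutator (CyclicExtension β))
    (hQ : commutator Q ≤ Subgroup.center Q) (q : CyclicExtension β →* Q)
    (hq : Function.Surjective q) (a : Q) : a ^ p ∈ Subgroup.center Q := by
  -- By bilinearity of the commutator, h ∈ S g is a symmetric relation. It holds for all base
  -- elements g, whose p-th powers become central, and t commutes with its own powers; these cases
  -- generate the rest.
  let S : CyclicExtension β → Subgroup (CyclicExtension β) := fun g =>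
    (Subgroup.centralizer {q g ^ p}).comap q
  have hS : ∀ g h, h ∈ S g ↔ ⁅q g ^ p, q h⁆ = 1 := fun g h => by
    rw [Subgroup.mem_comap, Subgroup.mem_centralizer_singleton_iff,
      commutatorElement_eq_one_iff_mul_comm, eq_comm]
  have hcomm : ∀ g h, h ∈ S g ↔ g ∈ S h := fun g h => by
    rw [hS, hS, ClassTwo.commutatorElement_pow_left hQ, ← commutatorElement_inv, inv_pow,
      ← ClassTwo.commutatorElement_pow_left hQ, inv_eq_one]
  have hinl : ∀ x, S (inl x) = ⊤ := fun x => by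
    refine (Subgroup.eq_top_iff' _).2 fun h => ?_
    rw [hS, ← map_pow]
    refine ClassTwo.commutatorElement_of_mem_left hQ ?_ _
    have h1 := Subgroup.mem_map_of_mem q (hβ x)
    rw [map_commutator_eq] at h1
    exact Subgroup.commutator_mono le_top le_top h1
  have hgen : S (gen β) = ⊤ := by
    refine eq_top_of_le (fun x => ?_) ?_
    · rw [hcomm, hinl]; trivial
    · rw [hS, commutatorElement_eq_one_iff_commute]
      exact (Commute.refl _).pow_left p
  have hall : ∀ g, S g = ⊤ := fun g => by
    refine eq_top_of_le (fun x => ?_) ?_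
    · rw [hcomm, hinl]; trivial
    · rw [hcomm, hgen]; trivial
  obtain ⟨g, rfl⟩ := hq a
  rw [Subgroup.mem_center_iff]
  intro b
  obtain ⟨h, rfl⟩ := hq b
  have h1 : h ∈ S g := by rw [hall]; trivial
  exact (commutatorElement_eq_one_iff_mul_comm.1 ((hS g h).1 h1)).symm

/-- The induction starts from class two, modulo γ₃; afterwards exponent p passes from one lower
central factor to the next. -/
theorem pow_mem_lowerCentralSeries_succ
    (hβ : ∀ x, (inl x : CyclicExtension β) ^ p ∈ commutator (CyclicExtension β)) (i : ℕ)
    {h : CyclicExtension β}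
    (hh : h ∈ (⊤ : Subgroup (CyclicExtension β)).lowerCentralSeries (i + 1)) :
    h ^ p ∈ (⊤ : Subgroup (CyclicExtension β)).lowerCentralSeries (i + 2) := by
  induction i generalizing h with
  | zero =>
    refine pow_mem_lowerCentralSeries_of_center (fun x _ => ?_) hh
    have hQ := map_lowerCentralSeries_le_center (G := CyclicExtension β) 1
    refine pow_mem_center_of_class_two hβ ?_ (QuotientGroup.mk' _) QuotientGroup.mk_surjective _
    refine le_trans ?_ hQ
    rw [Subgroup.top_lowerCentralSeries_one, map_commutator_eq,
      MonoidHom.range_eq_top.2 QuotientGroup.mk_surjective, commutator_def]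
  | succ i ih =>
    refine pow_mem_lowerCentralSeries_of_center (fun x hx => ?_) hh
    rw [← map_pow]
    exact map_lowerCentralSeries_le_center _ (Subgroup.mem_map_of_mem _ (ih hx))

theorem inl_pow_mem_lowerCentralSeries
    (hβ : ∀ x, (inl x : CyclicExtension β) ^ p ∈ commutator (CyclicExtension β)) (x : X) (i : ℕ) :
    (inl x : CyclicExtension β) ^ p ^ i ∈
      (⊤ : Subgroup (CyclicExtension β)).lowerCentralSeries i := by
  induction i with
  | zero => trivial
  | succ i ih =>
    rw [pow_succ, pow_mul]
    -- The top factor does not have exponent p, since t has infinite order in it, so the first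
    -- descent must use `hβ`.
    cases i with
    | zero => simpa [commutator_def] using hβ x
    | succ i => exact pow_mem_lowerCentralSeries_succ hβ i ih

/-- An isomorphism of cyclic extensions in which the base groups are the roots of the derived
subgroup restricts to the base groups. -/
theorem exists_baseEquiv (hp : p ≠ 0)
    (hβ : ∀ x, (inl x : CyclicExtension β) ^ p ∈ commutator (CyclicExtension β))
    (hγ : ∀ x, (inl x : CyclicExtension γ) ^ p ∈ commutator (CyclicExtension γ))
    (θ : CyclicExtension β ≃* CyclicExtension γ) :
    ∃ e : X ≃* Y, ∀ x, θ (inl x) = inl (e x) := by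
  have hθ : (inl : X →* CyclicExtension β).range.map θ.toMonoidHom =
      (inl : Y →* CyclicExtension γ).range := by
    ext h
    rw [← pow_mem_commutator_iff hp hγ, Subgroup.mem_map_equiv, ← pow_mem_commutator_iff hp hβ,
      ← map_pow, ← Subgroup.mem_map_equiv, map_commutator_eq, MonoidHom.range_eq_top.2 θ.surjective,
      commutator_def]
  let e : X ≃* Y := (MonoidHom.ofInjective inl_injective).trans
    (((θ.subgroupMap _).trans (MulEquiv.subgroupCongr hθ)).trans
      (MonoidHom.ofInjective inl_injective).symm)
  refine ⟨e, fun x => ?_⟩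
  have h1 : MonoidHom.ofInjective (inl_injective (φ := zpowersHom (MulAut Y) γ)) (e x) =
      MulEquiv.subgroupCongr hθ (θ.subgroupMap _ (MonoidHom.ofInjective inl_injective x)) :=
    MulEquiv.apply_symm_apply _ _
  exact (congrArg Subtype.val h1).symm

/-- Isomorphic cyclic extensions have isomorphic quotients by the derived subgroups of the base
groups. -/
theorem nonempty_mulEquiv_of_mulEquiv (hp : p ≠ 0)
    (hβ : ∀ x, (inl x : CyclicExtension β) ^ p ∈ commutator (CyclicExtension β))
    (hγ : ∀ x, (inl x : CyclicExtension γ) ^ p ∈ commutator (CyclicExtension γ))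
    {A B : Type*} [Group A] [Group B] {μ : MulAut A} {ν : MulAut B}
    (f : X →* A) (hf : ∀ x, f (β x) = μ (f x)) (hfs : Function.Surjective f)
    (hfk : f.ker = commutator X)
    (g : Y →* B) (hg : ∀ x, g (γ x) = ν (g x)) (hgs : Function.Surjective g)
    (hgk : g.ker = commutator Y)
    (θ : CyclicExtension β ≃* CyclicExtension γ) :
    Nonempty (CyclicExtension μ ≃* CyclicExtension ν) := by
  obtain ⟨e, he⟩ := exists_baseEquiv hp hβ hγ θ
  have hker : (mapHom f hf).ker.map θ.toMonoidHom = (mapHom g hg).ker := by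
    have hc : (commutator X).map e.toMonoidHom = commutator Y := by
      rw [map_commutator_eq, MonoidHom.range_eq_top.2 e.surjective, commutator_def]
    ext h
    rw [mem_ker_mapHom_iff, hgk, ← hc]
    constructor
    · rintro ⟨k, hk, rfl⟩
      obtain ⟨x, hx, rfl⟩ := (mem_ker_mapHom_iff hf k).1 hk
      exact ⟨e x, ⟨x, hfk ▸ hx, rfl⟩, (he x).symm⟩
    · rintro ⟨_, ⟨x, hx, rfl⟩, rfl⟩
      exact ⟨inl x, (mem_ker_mapHom_iff hf _).2 ⟨x, hfk ▸ hx, rfl⟩, he x⟩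
  exact ⟨(QuotientGroup.quotientKerEquivOfSurjective _ (mapHom_surjective hf hfs)).symm.trans
    ((QuotientGroup.congr _ _ θ hker).trans
      (QuotientGroup.quotientKerEquivOfSurjective _ (mapHom_surjective hg hgs)))⟩

end CyclicExtension

/-! ### A class-two group detecting the derived subgroup -/

/-- The group `ℤ^r × M_r(ℤ)` with multiplication `(v, A) (w, B) = (v + w, A + B + v wᵀ)`, a
nilpotent group of class two. -/
@[ext]
structure TensorHeisenberg (r : ℕ) where
  /-- the vector component -/
  vec : Fin r → ℤ
  /-- the matrix component -/
  mat : Fin r → Fin r → ℤ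

namespace TensorHeisenberg

variable {r : ℕ}

instance : Mul (TensorHeisenberg r) :=
  ⟨fun a b => ⟨a.vec + b.vec, fun i j => a.mat i j + b.mat i j + a.vec i * b.vec j⟩⟩

instance : One (TensorHeisenberg r) := ⟨⟨0, 0⟩⟩

instance : Inv (TensorHeisenberg r) :=
  ⟨fun a => ⟨-a.vec, fun i j => -a.mat i j + a.vec i * a.vec j⟩⟩

theorem vec_mul (a b : TensorHeisenberg r) : (a * b).vec = a.vec + b.vec := rfl

theorem mat_mul (a b : TensorHeisenberg r) (i j : Fin r) :
    (a * b).mat i j = a.mat i j + b.mat i j + a.vec i * b.vec j := rfl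

instance : Group (TensorHeisenberg r) :=
  Group.ofLeftAxioms
    (fun a b c => by
      ext <;> simp only [vec_mul, mat_mul, Pi.add_apply] <;> ring)
    (fun a => by
      ext
      · exact zero_add _
      · change 0 + a.mat _ _ + 0 * a.vec _ = _
        ring)
    (fun a => by
      ext
      · exact neg_add_cancel _
      · change -a.mat _ _ + a.vec _ * a.vec _ + a.mat _ _ + -a.vec _ * a.vec _ = 0
        ring)

/-- The projection to the vector component. -/
def vecHom : TensorHeisenberg r →* Multiplicative (Fin r → ℤ) :=
  MonoidHom.mk' (fun a => Multiplicative.ofAdd a.vec) fun _ _ => rfl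

theorem vec_eq_zero {z : TensorHeisenberg r} (hz : z ∈ commutator (TensorHeisenberg r)) :
    z.vec = 0 :=
  Abelianization.commutator_subset_ker vecHom hz

theorem commutator_le_center :
    commutator (TensorHeisenberg r) ≤ Subgroup.center (TensorHeisenberg r) := by
  intro z hz
  rw [Subgroup.mem_center_iff]
  intro g
  have h := vec_eq_zero hz
  ext <;> simp only [vec_mul, mat_mul, h, Pi.add_apply, Pi.zero_apply] <;> ring

/-- Commutators of the unit vectors are the matrices E_ij - E_ji, independent for i < j; this is
what shows N' to be free of hidden relations. -/
theorem mat_commutatorElement (a b : TensorHeisenberg r) (i j : Fin r) :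
    ⁅a, b⁆.mat i j = a.vec i * b.vec j - b.vec i * a.vec j := by
  have h1 : ⁅a, b⁆ * (b * a) = a * b := by rw [commutatorElement_def]; group
  have h2 := congrArg (fun c => c.mat i j) h1
  simp only [mat_mul, vec_eq_zero (ClassTwo.commutator_mem a b), Pi.zero_apply] at h2
  linarith

end TensorHeisenberg

/-! ### Free abelian groups -/

theorem Int.eq_zero_of_forall_pow_dvd {p : ℕ} (hp : 2 ≤ p) {a : ℤ}
    (h : ∀ k : ℕ, ((p ^ k : ℕ) : ℤ) ∣ a) : a = 0 := by
  by_contra ha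
  have h1 := Nat.le_of_dvd (Int.natAbs_pos.2 ha) (Int.natCast_dvd.1 (h a.natAbs))
  exact absurd h1 (not_le.2 (Nat.lt_pow_self hp))

/-- An element of a free abelian group divisible by all powers of `p` vanishes. -/
theorem eq_one_of_forall_exists_pow {ι : Type*} {p : ℕ} (hp : 2 ≤ p)
    {a : Multiplicative (ι → ℤ)} (h : ∀ k : ℕ, ∃ b, a = b ^ p ^ k) : a = 1 := by
  change Multiplicative.toAdd a = 0
  funext i
  refine Int.eq_zero_of_forall_pow_dvd hp fun k => ?_
  obtain ⟨b, rfl⟩ := h k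
  exact ⟨Multiplicative.toAdd b i, by simp⟩

theorem exists_freeAbelian_hom {ι C : Type*} [Fintype ι] [DecidableEq ι] [CommGroup C]
    (c : ι → C) :
    ∃ s : Multiplicative (ι → ℤ) →* C, ∀ i, s (Multiplicative.ofAdd (Pi.single i 1)) = c i := by
  refine ⟨MonoidHom.mk' (fun A => ∏ i, c i ^ Multiplicative.toAdd A i)
    fun v w => by simp [zpow_add, Finset.prod_mul_distrib], fun i => ?_⟩
  change ∏ j, c j ^ (Pi.single i 1 : ι → ℤ) j = _
  rw [Finset.prod_eq_single i]
  · simp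
  · intro j _ hj
    simp [Pi.single_eq_of_ne hj]
  · simp

theorem exists_freeAbelian_hom_of_mem_center {ι G : Type*} [Fintype ι] [DecidableEq ι] [Group G]
    (c : ι → G) (hc : ∀ i, c i ∈ Subgroup.center G) :
    ∃ s : Multiplicative (ι → ℤ) →* G, ∀ i, s (Multiplicative.ofAdd (Pi.single i 1)) = c i := by
  let inst : CommGroup (Subgroup.center G) :=
    { (inferInstance : Group (Subgroup.center G)) with
      mul_comm := fun a b => Subtype.ext (Subgroup.mem_center_iff.1 b.2 a) }
  obtain ⟨s, hs⟩ := exists_freeAbelian_hom (C := Subgroup.center G) fun i => ⟨c i, hc i⟩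
  exact ⟨(Subgroup.center G).subtype.comp s, fun i => congrArg Subtype.val (hs i)⟩

/-! ### The free nilpotent group of class two -/

namespace FreeNilpotentTwo

variable {N : Type u} [Group N] {r : ℕ}

/-- The free nilpotent group of class two on `r` generators. -/
abbrev Model (r : ℕ) : Type :=
  FreeGroup (Fin r) ⧸ (⊤ : Subgroup (FreeGroup (Fin r))).lowerCentralSeries 2

/-- The free generators. -/
def basis (e : N ≃* Model r) (i : Fin r) : N := e.symm (FreeGroup.of i : FreeGroup (Fin r))

theorem closure_basis (e : N ≃* Model r) : Subgroup.closure (Set.range (basis e)) = ⊤ := by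
  have h1 : Set.range (basis e) =
      (e.symm.toMonoidHom.comp (QuotientGroup.mk' _)) '' Set.range FreeGroup.of := by
    rw [← Set.range_comp]; rfl
  rw [h1, ← MonoidHom.map_closure, FreeGroup.closure_range_of, ← MonoidHom.range_eq_map,
    MonoidHom.range_eq_top]
  exact e.symm.surjective.comp QuotientGroup.mk_surjective

theorem fg (e : N ≃* Model r) : Group.FG N :=
  Group.fg_iff.2 ⟨_, closure_basis e, Set.finite_range _⟩

theorem commutator_le_center (e : N ≃* Model r) : commutator N ≤ Subgroup.center N := by
  have h1 : (⊤ : Subgroup N).lowerCentralSeries 2 = ⊥ := by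
    have h2 := Subgroup.map_lowerCentralSeries (⊤ : Subgroup (FreeGroup (Fin r)))
      (e.symm.toMonoidHom.comp (QuotientGroup.mk' _)) 2
    rw [← MonoidHom.range_eq_map, MonoidHom.range_eq_top.2
      (e.symm.surjective.comp QuotientGroup.mk_surjective), ← Subgroup.map_map,
      QuotientGroup.map_mk'_self, Subgroup.map_bot] at h2
    exact h2.symm
  rwa [← Subgroup.commutator_top_right_eq_bot_iff_le_center]

/-- The universal property of the free nilpotent group of class two. -/
theorem exists_hom (e : N ≃* Model r) {Y : Type w} [Group Y]
    (hY : commutator Y ≤ Subgroup.center Y)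
    (y : Fin r → Y) : ∃ f : N →* Y, ∀ i, f (basis e i) = y i := by
  have h1 : (⊤ : Subgroup (FreeGroup (Fin r))).lowerCentralSeries 2 ≤ (FreeGroup.lift y).ker := by
    refine (lowerCentralSeries_le_comap_hom (FreeGroup.lift y) 2).trans ?_
    have h2 : (⊤ : Subgroup Y).lowerCentralSeries 2 = ⊥ :=
      Subgroup.commutator_top_right_eq_bot_iff_le_center.2 hY
    rw [h2]
    exact le_rfl
  exact ⟨(QuotientGroup.lift _ _ h1).comp e.toMonoidHom, fun i => by
    simp only [basis, MonoidHom.comp_apply, MulEquiv.toMonoidHom_eq_coe, MonoidHom.coe_coe,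
      MulEquiv.apply_symm_apply]
    exact FreeGroup.lift_apply_of⟩

theorem hom_ext (e : N ≃* Model r) {Y : Type w} [Group Y] {f g : N →* Y}
    (h : ∀ i, f (basis e i) = g (basis e i)) :
    f = g :=
  MonoidHom.eq_of_eqOn_dense (closure_basis e) (by rintro _ ⟨i, rfl⟩; exact h i)

theorem exists_lift_end (e : N ≃* Model r) (μ : Abelianization N →* Abelianization N) :
    ∃ f : N →* N, ∀ x, Abelianization.of (f x) = μ (Abelianization.of x) := by
  choose y hy using fun i => Abelianization.of_surjective (μ (Abelianization.of (basis e i)))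
  obtain ⟨f, hf⟩ := exists_hom e (commutator_le_center e) y
  have h : Abelianization.of.comp f = μ.comp Abelianization.of :=
    hom_ext e fun i => by simp [hf, hy]
  exact ⟨f, DFunLike.congr_fun h⟩

/-- Every automorphism of the abelianization lifts. -/
theorem exists_lift_aut (e : N ≃* Model r) (μ : MulAut (Abelianization N)) :
    ∃ α : MulAut N, ∀ x, Abelianization.of (α x) = μ (Abelianization.of x) := by
  obtain ⟨f, hf⟩ := exists_lift_end e μ.toMonoidHom
  obtain ⟨g, hg⟩ := exists_lift_end e (μ⁻¹ : MulAut _).toMonoidHom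
  -- Lifts of μ and of its inverse need not be mutually inverse, but both composites induce the
  -- identity on N/N', hence are bijective.
  have h1 := ClassTwo.bijective_of_mul_inv_mem (commutator_le_center e) (g.comp f) fun x => by
    rw [← Abelianization.of_eq_of_iff, MonoidHom.comp_apply, hg, hf]
    exact MulAut.inv_apply_self _ μ _
  have h2 := ClassTwo.bijective_of_mul_inv_mem (commutator_le_center e) (f.comp g) fun x => by
    rw [← Abelianization.of_eq_of_iff, MonoidHom.comp_apply, hf, hg]
    exact MulAut.apply_inv_self _ μ _
  exact ⟨MulEquiv.ofBijective f ⟨Function.Injective.of_comp h1.1, Function.Surjective.of_comp h2.2⟩,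
    hf⟩

/-- The abelianization embeds in `ℤ^r`. -/
theorem exists_hom_ker_le (e : N ≃* Model r)
    : ∃ f : N →* Multiplicative (Fin r → ℤ), f.ker ≤ commutator N := by
  obtain ⟨f, hf⟩ := exists_hom e (Y := Multiplicative (Fin r → ℤ))
    (by rw [CommGroup.center_eq_top]; exact le_top)
    (fun i => Multiplicative.ofAdd (Pi.single i 1))
  obtain ⟨t, ht⟩ := exists_freeAbelian_hom fun i => Abelianization.of (basis e i)
  have h : t.comp f = Abelianization.of := hom_ext e fun i => by
    rw [MonoidHom.comp_apply, hf, ht]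
  refine ⟨f, fun x hx => ?_⟩
  rw [← Abelianization.of_eq_one_iff, ← h, MonoidHom.comp_apply, MonoidHom.mem_ker.1 hx, map_one]

theorem commutator_le_closure (e : N ≃* Model r) :
    commutator N ≤ Subgroup.closure {z | ∃ i j, z = ⁅basis e i, basis e j⁆} := by
  set K := Subgroup.closure {z | ∃ i j, z = ⁅basis e i, basis e j⁆}
  have hc := commutator_le_center e
  have hS : ∀ g, (∀ i, ⁅basis e i, g⁆ ∈ K) → ∀ a, ⁅a, g⁆ ∈ K := fun g hg a => by
    have h1 : Subgroup.closure (Set.range (basis e)) ≤ K.comap (ClassTwo.commutatorHom hc g) := by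
      rw [Subgroup.closure_le]
      rintro _ ⟨i, rfl⟩
      exact hg i
    rw [closure_basis] at h1
    exact h1 (Subgroup.mem_top a)
  rw [commutator_def, Subgroup.commutator_le]
  intro a _ b _
  refine hS b (fun i => ?_) a
  rw [← commutatorElement_inv, inv_mem_iff]
  exact hS _ (fun j => Subgroup.subset_closure ⟨j, i, rfl⟩) b

/-- The derived subgroup embeds in a free abelian group. -/
theorem exists_commutator_embedding (e : N ≃* Model r) :
    ∃ f : commutator N →* Multiplicative (Fin r × Fin r → ℤ), Function.Injective f := by
  have hc := commutator_le_center e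
  obtain ⟨ψ, hψ⟩ := exists_hom e TensorHeisenberg.commutator_le_center
    (fun i : Fin r => (⟨Pi.single i 1, 0⟩ : TensorHeisenberg r))
  have hψc : ∀ z ∈ commutator N, (ψ z).vec = 0 := fun z hz => by
    have h1 := Subgroup.mem_map_of_mem ψ hz
    rw [map_commutator_eq] at h1
    exact TensorHeisenberg.vec_eq_zero (Subgroup.commutator_mono le_top le_top h1)
  let f : commutator N →* Multiplicative (Fin r × Fin r → ℤ) :=
    MonoidHom.mk' (fun z => Multiplicative.ofAdd fun q => (ψ z).mat q.1 q.2) fun a b => by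
      rw [← ofAdd_add]
      congr 1
      funext q
      simp [TensorHeisenberg.mat_mul, hψc a a.2]
  -- A left inverse of f. Only the E_ij with i < j get a nontrivial value, so that E_ij - E_ji goes
  -- to [b_i,b_j] for either order of i and j.
  obtain ⟨s, hs⟩ := exists_freeAbelian_hom_of_mem_center
    (fun q : Fin r × Fin r => if q.1 < q.2 then ⁅basis e q.1, basis e q.2⁆ else 1)
    (fun q => by
      split_ifs
      · exact hc (ClassTwo.commutator_mem _ _)
      · exact one_mem _)
  have hgen : ∀ i j, s (f ⟨⁅basis e i, basis e j⁆, ClassTwo.commutator_mem _ _⟩) =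
      ⁅basis e i, basis e j⁆ := fun i j => by
    have h1 : f ⟨⁅basis e i, basis e j⁆, ClassTwo.commutator_mem _ _⟩ =
        Multiplicative.ofAdd (Pi.single (i, j) 1) / Multiplicative.ofAdd (Pi.single (j, i) 1) := by
      rw [← ofAdd_sub]
      change Multiplicative.ofAdd _ = _
      congr 1
      funext q
      simp only [map_commutatorElement, TensorHeisenberg.mat_commutatorElement, hψ, Pi.sub_apply,
        Pi.single_apply, Prod.ext_iff]
      split_ifs <;> simp_all
    rw [h1, map_div, hs, hs]
    rcases lt_trichotomy i j with h | h | h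
    · simp [h, h.not_gt]
    · subst h; simp
    · simp [h, h.not_gt]
  have hsf : Subgroup.closure {z | ∃ i j, z = ⁅basis e i, basis e j⁆} ≤
      ((s.comp f).eqLocus (commutator N).subtype).map (commutator N).subtype := by
    rw [Subgroup.closure_le]
    rintro _ ⟨i, j, rfl⟩
    exact ⟨_, hgen i j, rfl⟩
  have hleft : ∀ a : commutator N, s (f a) = a := fun a => by
    obtain ⟨b, hb, hba⟩ := hsf (commutator_le_closure e a.2)
    rw [← Subtype.ext hba]
    exact hb
  refine ⟨f, fun a b hab => Subtype.ext ?_⟩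
  rw [← hleft a, ← hleft b, hab]

/-- This and the next two lemmas are all that the residual nilpotence argument uses of freeness
beyond class two. -/
theorem mem_commutator_of_pow_mem (e : N ≃* Model r)
    {x : N} {n : ℕ} (hn : n ≠ 0) (h : x ^ n ∈ commutator N) :
    x ∈ commutator N := by
  obtain ⟨f, hf⟩ := exists_hom_ker_le e
  have h1 : f x ^ n = 1 := by
    rw [← map_pow]; exact Abelianization.commutator_subset_ker f h
  exact hf ((pow_eq_one_iff_left hn).1 h1)

theorem mem_commutator_of_forall_pow (e : N ≃* Model r) {p : ℕ} (hp : 2 ≤ p) {x : N}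
    (h : ∀ k : ℕ, ∃ y, x * (y ^ p ^ k)⁻¹ ∈ commutator N) : x ∈ commutator N := by
  obtain ⟨f, hf⟩ := exists_hom_ker_le e
  refine hf (eq_one_of_forall_exists_pow hp fun k => ?_)
  obtain ⟨y, hy⟩ := h k
  have h1 : f (x * (y ^ p ^ k)⁻¹) = 1 := Abelianization.commutator_subset_ker f hy
  rw [map_mul, map_inv, map_pow, mul_inv_eq_one] at h1
  exact ⟨f y, h1⟩

theorem eq_one_of_mem_commutator_of_forall_pow (e : N ≃* Model r) {p : ℕ} (hp : 2 ≤ p) {z : N}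
    (h : ∀ k : ℕ, ∃ w ∈ commutator N, z = w ^ p ^ k) : z = 1 := by
  obtain ⟨f, hf⟩ := exists_commutator_embedding e
  obtain ⟨w, hw, hzw⟩ := h 0
  have hz : z ∈ commutator N := hzw ▸ pow_mem hw _
  have h1 : (⟨z, hz⟩ : commutator N) = 1 := by
    refine hf ?_
    rw [map_one]
    refine eq_one_of_forall_exists_pow hp fun k => ?_
    obtain ⟨w, hw, hzw⟩ := h k
    refine ⟨f ⟨w, hw⟩, ?_⟩
    rw [← map_pow]
    exact congrArg f (Subtype.ext hzw)
  exact congrArg Subtype.val h1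

end FreeNilpotentTwo

/-! ### Unipotence modulo p^k of automorphisms of order dividing p -/

/-- Modulo p, (T-1)^p is T^p + (-1)^p = 1 + (-1)^p, which is 0 for odd p and 2 for p = 2. -/
theorem exists_sub_one_pow_prime_eq {R : Type*} [Ring R] {p : ℕ} (hp : p.Prime) {T : R}
    (hT : T ^ p = 1) : ∃ s : R, (T - 1) ^ p = p * s := by
  obtain ⟨r, hr⟩ := (Commute.neg_one_right T).exists_add_pow_prime_eq hp
  rw [← sub_eq_add_neg, hT] at hr
  rcases hp.eq_two_or_odd' with rfl | hodd
  · exact ⟨1 + T * -1 * r, by rw [hr]; push_cast; noncomm_ring⟩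
  · rw [hodd.neg_one_pow, add_neg_cancel, zero_add] at hr
    exact ⟨T * -1 * r, by rw [hr]; noncomm_ring⟩

/-- An automorphism `τ` of `p`-power order of an abelian group acts nilpotently modulo
`p^k`-th powers: there is a finite filtration, central for `τ`, ending in the `p^k`-th powers. -/
theorem MulAut.exists_filtration {X : Type*} [CommGroup X] (τ : MulAut X)
    {p : ℕ} (hp : p.Prime) (hτ : τ ^ p = 1) (k : ℕ) :
    ∃ (J : ℕ) (R : ℕ → Subgroup X), R 0 = ⊤ ∧ (∀ j x, τ x ∈ R j ↔ x ∈ R j) ∧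
      (∀ j, ∀ x ∈ R j, τ x * x⁻¹ ∈ R (j + 1)) ∧ ∀ x ∈ R J, ∃ y, x = y ^ p ^ k := by
  let T : AddMonoid.End (Additive X) := MonoidHom.toAdditive τ.toMonoidHom
  have hmul : ∀ (f g : AddMonoid.End (Additive X)) (x : Additive X), (f * g) x = f (g x) :=
    fun _ _ _ => rfl
  have hTn : ∀ (n : ℕ) (x : Additive X), (T ^ n) x = Additive.ofMul ((τ ^ n) x.toMul) := by
    intro n
    induction n with
    | zero => intro x; rfl
    | succ n ih =>
      intro x
      rw [pow_succ, hmul, ih, pow_succ, MulAut.mul_apply]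
      rfl
  have hT : T ^ p = 1 := by
    ext x
    rw [hTn, hτ]
    rfl
  obtain ⟨s, hs⟩ := exists_sub_one_pow_prime_eq hp hT
  -- The filtration by the images of (T-1)^j. It ends at J = pk because (T-1)^(pk) = p^k s^k.
  let R : ℕ → Subgroup X := fun j =>
    AddSubgroup.toSubgroup' (AddMonoidHom.range ((T - 1) ^ j : AddMonoid.End (Additive X)))
  have hR : ∀ j x, x ∈ R j ↔ ∃ w, ((T - 1) ^ j) w = Additive.ofMul x := fun j x => Iff.rfl
  have hcomm : ∀ n j, T ^ n * (T - 1) ^ j = (T - 1) ^ j * T ^ n := fun n j =>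
    (((Commute.refl T).sub_right (Commute.one_right T)).pow_pow n j).eq
  have hstable : ∀ n j x, x ∈ R j → (τ ^ n) x ∈ R j := by
    intro n j x hx
    obtain ⟨w, hw⟩ := (hR j x).1 hx
    refine (hR j _).2 ⟨(T ^ n) w, ?_⟩
    rw [← hmul, ← hcomm, hmul, hw, hTn]
    rfl
  refine ⟨p * k, R, ?_, fun j x => ⟨fun h => ?_, fun h => ?_⟩, ?_, ?_⟩
  · exact (Subgroup.eq_top_iff' _).2 fun x => ⟨Additive.ofMul x, rfl⟩
  -- The inverse of τ is τ^(p-1), so stability under positive powers suffices.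
  · have h1 := hstable (p - 1) j _ h
    rwa [← MulAut.mul_apply, ← pow_succ, Nat.sub_add_cancel hp.one_le, hτ, MulAut.one_apply] at h1
  · simpa using hstable 1 j x h
  · intro j x hx
    obtain ⟨w, hw⟩ := (hR j x).1 hx
    refine (hR _ _).2 ⟨w, ?_⟩
    rw [pow_succ', hmul, hw]
    exact sub_eq_add_neg _ _
  · intro x hx
    obtain ⟨w, hw⟩ := (hR _ x).1 hx
    refine ⟨((s ^ k) w).toMul, ?_⟩
    rw [pow_mul, hs, (Nat.cast_commute p s).mul_pow, hmul, ← Nat.cast_pow,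
      AddMonoid.End.natCast_apply] at hw
    exact hw.symm

theorem coe_restrictAut {N : Type*} [Group N] (α : MulAut N) (M : Subgroup N)
    (hM : M.map (MulEquiv.toMonoidHom α) = M) (x : M) : (restrictAut α M hM x : N) = α x := rfl

theorem coe_restrictAut_pow {N : Type*} [Group N] (α : MulAut N) (M : Subgroup N)
    (hM : M.map (MulEquiv.toMonoidHom α) = M) (n : ℕ) (x : M) :
    ((restrictAut α M hM ^ n) x : N) = (α ^ n) x := by
  simpa using MulAut.zpow_intertwines (β := restrictAut α M hM) (γ := α) (f := M.subtype)
    (coe_restrictAut α M hM) n x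

/-! ### Central chains in cyclic extensions -/

namespace CyclicExtension

variable {X : Type*} [Group X] {β : MulAut X}

theorem map_inl_normal {K : Subgroup X} [hK : K.Normal]
    (hKβ : K.map (MulEquiv.toMonoidHom β) = K) :
    (K.map (inl : X →* CyclicExtension β)).Normal := by
  rw [← Subgroup.normalizer_eq_top_iff]
  refine eq_top_of_le (fun y => ?_) ?_
  · rw [Subgroup.mem_normalizer_iff]
    intro h
    constructor
    · rintro ⟨x, hx, rfl⟩
      exact ⟨_, hK.conj_mem x hx y, by simp⟩
    · rintro ⟨x, hx, hxh⟩
      refine ⟨_, hK.conj_mem x hx y⁻¹, ?_⟩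
      rw [map_mul, map_mul, hxh]
      simp [mul_assoc]
  · rw [Subgroup.mem_normalizer_iff]
    intro h
    constructor
    · rintro ⟨x, hx, rfl⟩
      exact ⟨β x, hKβ ▸ Subgroup.mem_map_of_mem _ hx, inl_apply x⟩
    · rintro ⟨x, hx, hxh⟩
      rw [← hKβ] at hx
      obtain ⟨y, hy, rfl⟩ := hx
      refine ⟨y, hy, ?_⟩
      have h1 : inl (β y) = gen β * h * (gen β)⁻¹ := hxh
      rw [inl_apply] at h1
      exact mul_left_cancel (mul_right_cancel h1)

/-- Modulo K', an element of K commutes with X by `h1` and with t by `h2`, hence with everything. -/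
theorem commutator_map_inl_le {K K' : Subgroup X} [K'.Normal]
    (hKβ : K'.map (MulEquiv.toMonoidHom β) = K') (h1 : ∀ x ∈ K, ∀ y, ⁅x, y⁆ ∈ K')
    (h2 : ∀ x ∈ K, β x * x⁻¹ ∈ K') :
    ⁅K.map (inl : X →* CyclicExtension β), (⊤ : Subgroup (CyclicExtension β))⁆ ≤
      K'.map inl := by
  have hn := map_inl_normal hKβ
  rw [Subgroup.commutator_le]
  rintro _ ⟨x, hx, rfl⟩ g _
  let q := QuotientGroup.mk' (K'.map (inl : X →* CyclicExtension β))
  have hS : ∀ g : CyclicExtension β, g ∈ (Subgroup.centralizer {q (inl x)}).comap q ↔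
      ⁅(inl x : CyclicExtension β), g⁆ ∈ K'.map inl := by
    intro g
    rw [Subgroup.mem_comap, Subgroup.mem_centralizer_singleton_iff, ← QuotientGroup.eq_one_iff]
    change _ ↔ q ⁅inl x, g⁆ = 1
    rw [map_commutatorElement, commutatorElement_eq_one_iff_mul_comm, eq_comm]
  rw [← hS, eq_top_of_le (S := (Subgroup.centralizer {q (inl x)}).comap q)]
  · trivial
  · intro y
    rw [hS, ← map_commutatorElement]
    exact Subgroup.mem_map_of_mem _ (h1 x hx y)
  · rw [hS]
    refine ⟨(β x * x⁻¹)⁻¹, inv_mem (h2 x hx), ?_⟩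
    rw [mul_inv_rev, inv_inv, map_mul, map_inv, inl_apply, commutatorElement_def]
    group

/-- The offset c allows chains to be concatenated: one through N/N', then one through N'. -/
theorem lowerCentralSeries_le_of_chain (K : ℕ → Subgroup X) (hn : ∀ j, (K j).Normal)
    (hKβ : ∀ j, (K j).map (MulEquiv.toMonoidHom β) = K j)
    (h1 : ∀ j, ∀ x ∈ K j, ∀ y, ⁅x, y⁆ ∈ K (j + 1)) (h2 : ∀ j, ∀ x ∈ K j, β x * x⁻¹ ∈ K (j + 1))
    {c : ℕ} (hc : (⊤ : Subgroup (CyclicExtension β)).lowerCentralSeries c ≤ (K 0).map inl)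
    (j : ℕ) : (⊤ : Subgroup (CyclicExtension β)).lowerCentralSeries (c + j) ≤ (K j).map inl := by
  induction j with
  | zero => exact hc
  | succ j ih =>
    have := hn (j + 1)
    exact (Subgroup.commutator_mono ih le_rfl).trans
      (commutator_map_inl_le (hKβ (j + 1)) (h1 j) (h2 j))

end CyclicExtension

/-! ### Residual nilpotence -/

/-- The exponents k+1 and k in `powSubgroup` come from here: the commutator correction to a
p^(k+1)-th power must be a p^k-th power, also when p = 2. -/
theorem Nat.pow_dvd_choose_two (p k : ℕ) : p ^ k ∣ (p ^ (k + 1)).choose 2 := by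
  have h : 2 ∣ p * (p ^ (k + 1) - 1) := by
    rcases Nat.even_or_odd p with hp | hp
    · exact (hp.mul_right _).two_dvd
    · exact (Even.mul_left (Nat.Odd.sub_odd hp.pow odd_one) _).two_dvd
  obtain ⟨t, ht⟩ := h
  refine ⟨t, ?_⟩
  rw [Nat.choose_two_right]
  refine Nat.div_eq_of_eq_mul_right two_pos ?_
  rw [pow_succ, mul_assoc, ← pow_succ, ht]
  ring

namespace ClassTwo

variable {N : Type*} [Group N]

/-- The subgroup of the elements `y^(p^(k+1)) z^(p^k)` with `z` in the derived subgroup. -/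
def powSubgroup (hc : commutator N ≤ Subgroup.center N) (p k : ℕ) : Subgroup N where
  carrier := {x | ∃ y, ∃ z ∈ commutator N, x = y ^ p ^ (k + 1) * z ^ p ^ k}
  one_mem' := ⟨1, 1, one_mem _, by simp⟩
  mul_mem' := by
    rintro _ _ ⟨y₁, z₁, h₁, rfl⟩ ⟨y₂, z₂, h₂, rfl⟩
    obtain ⟨t, ht⟩ := Nat.pow_dvd_choose_two p k
    have hcm := commutator_mem y₂ y₁
    refine ⟨y₁ * y₂, (⁅y₂, y₁⁆ ^ t)⁻¹ * (z₁ * z₂),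
      mul_mem (inv_mem (pow_mem hcm t)) (mul_mem h₁ h₂), ?_⟩
    rw [mul_pow_eq hc, ht, (commute hc (inv_mem (pow_mem hcm t)) _).mul_pow,
      (commute hc h₁ _).mul_pow, inv_pow, ← pow_mul, mul_comm t]
    rw [mul_assoc, mul_assoc, mul_inv_cancel_left, mul_assoc,
      ← mul_assoc (z₁ ^ _), ((commute hc h₁ _).pow_left _).eq]
    simp only [mul_assoc]
  inv_mem' := by
    rintro _ ⟨y, z, hz, rfl⟩
    refine ⟨y⁻¹, z⁻¹, inv_mem hz, ?_⟩
    rw [mul_inv_rev, inv_pow, inv_pow]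
    exact (((commute hc hz _).pow_left _).inv_left).eq

instance powSubgroup_characteristic (hc : commutator N ≤ Subgroup.center N) (p k : ℕ) :
    (powSubgroup hc p k).Characteristic := by
  rw [Subgroup.characteristic_iff_map_le]
  rintro φ _ ⟨_, ⟨y, z, hz, rfl⟩, rfl⟩
  refine ⟨φ y, φ z, ?_, by simp⟩
  have h1 := Subgroup.mem_map_of_mem φ.toMonoidHom hz
  rwa [Subgroup.characteristic_iff_map_eq.1 inferInstance φ] at h1

/-- A cyclic extension of a group of class at most two by a lift of an automorphism of
prime order is nilpotent modulo the subgroups `powSubgroup`. -/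
theorem exists_lowerCentralSeries_le (hc : commutator N ≤ Subgroup.center N) {p : ℕ}
    (hp : p.Prime) (α : MulAut N) (μ : MulAut (Abelianization N)) (hμ : μ ^ p = 1)
    (hα : ∀ x, Abelianization.of (α x) = μ (Abelianization.of x)) (k : ℕ) :
    ∃ i, (⊤ : Subgroup (CyclicExtension α)).lowerCentralSeries i ≤
      (powSubgroup hc p k).map inl := by
  set D := powSubgroup hc p k
  have hcα : (commutator N).map (MulEquiv.toMonoidHom α) = commutator N :=
    Subgroup.characteristic_iff_map_eq.1 inferInstance α
  have hDα : D.map (MulEquiv.toMonoidHom α) = D :=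
    Subgroup.characteristic_iff_map_eq.1 inferInstance α
  have hcomm : ∀ a b : commutator N, a * b = b * a := fun a b =>
    Subtype.ext (commute hc a.2 b).eq
  -- α^p induces μ^p = 1 on N/N', so it fixes N' pointwise; thus N' carries an automorphism of order
  -- dividing p as well.
  have hαp : ∀ z ∈ commutator N, (α ^ p) z = z := fun z hz => by
    refine map_eq_self_of_mem_commutator hc (MulEquiv.toMonoidHom (α ^ p)) (fun x => ?_) hz
    rw [← Abelianization.of_eq_of_iff]
    have := MulAut.zpow_intertwines hα p x
    rw [zpow_natCast, zpow_natCast, hμ] at this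
    exact this
  obtain ⟨J, R, hR0, hRμ, hR1, hRJ⟩ := μ.exists_filtration hp hμ (k + 1)
  obtain ⟨J', R', hR0', hRα', hR1', hRJ'⟩ :
      ∃ (J : ℕ) (R : ℕ → Subgroup (commutator N)), R 0 = ⊤ ∧
      (∀ j x, restrictAut α _ hcα x ∈ R j ↔ x ∈ R j) ∧
      (∀ j, ∀ x ∈ R j, restrictAut α _ hcα x * x⁻¹ ∈ R (j + 1)) ∧
      ∀ x ∈ R J, ∃ y, x = y ^ p ^ k := by
    let inst : CommGroup (commutator N) :=
      { (inferInstance : Group (commutator N)) with mul_comm := hcomm }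
    refine MulAut.exists_filtration (X := commutator N) (restrictAut α _ hcα) hp ?_ k
    ext x
    rw [coe_restrictAut_pow, hαp x x.2]
    rfl
  -- The first chain descends from N to the preimage of the p^(k+1)-th powers of N/N', which lies in
  -- D N'.
  have h1 : ∀ j, (⊤ : Subgroup (CyclicExtension α)).lowerCentralSeries (1 + j) ≤
      ((R j).comap Abelianization.of).map inl := by
    refine CyclicExtension.lowerCentralSeries_le_of_chain (fun j => (R j).comap Abelianization.of)
      (fun j => inferInstance) (fun j => ?_) (fun j x _ y => ?_) (fun j x hx => ?_) ?_
    · ext x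
      rw [Subgroup.mem_map_equiv, Subgroup.mem_comap, ← hRμ, ← hα]
      simp
    · rw [Subgroup.mem_comap, Abelianization.of_eq_one_iff.2 (commutator_mem x y)]
      exact one_mem _
    · rw [Subgroup.mem_comap, map_mul, map_inv, hα]
      exact hR1 j _ hx
    · rw [hR0, Subgroup.comap_top, ← MonoidHom.range_eq_map]
      exact CyclicExtension.commutator_le_range_inl
  -- The second chain descends from D N' to D, through the filtration of N'.
  let K : ℕ → Subgroup N := fun j => D ⊔ (R' j).map (commutator N).subtype
  have hRle : ∀ j, (R' j).map (commutator N).subtype ≤ commutator N := by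
    rintro j _ ⟨z, _, rfl⟩
    exact z.2
  have hRn : ∀ j, ((R' j).map (commutator N).subtype).Normal := fun j =>
    ⟨fun z hz g => by
      rw [← (commute hc (hRle j hz) g).eq, mul_inv_cancel_right]
      exact hz⟩
  have hK : ∀ j x, x ∈ K j ↔ ∃ d ∈ D, ∃ z ∈ R' j, d * (z : N) = x := fun j x => by
    have := hRn j
    rw [Subgroup.mem_sup_of_normal_right]
    simp
  have h2 : ∀ j, (⊤ : Subgroup (CyclicExtension α)).lowerCentralSeries (1 + J + j) ≤
      (K j).map inl := by
    refine CyclicExtension.lowerCentralSeries_le_of_chain K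
      (fun j => by have := hRn j; infer_instance) (fun j => ?_) (fun j x hx y => ?_)
      (fun j x hx => ?_) ((h1 J).trans (Subgroup.map_mono fun x hx => ?_))
    · rw [Subgroup.map_sup, hDα]
      congr 1
      ext x
      constructor
      · rintro ⟨_, ⟨z, hz, rfl⟩, rfl⟩
        exact ⟨_, (hRα' j z).2 hz, rfl⟩
      · rintro ⟨z, hz, rfl⟩
        obtain ⟨w, rfl⟩ := (restrictAut α _ hcα).surjective z
        exact ⟨w, ⟨w, (hRα' j w).1 hz, rfl⟩, rfl⟩
    · obtain ⟨d, hd, z, hz, rfl⟩ := (hK j x).1 hx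
      rw [commutatorElement_mul_left hc, commutatorElement_of_mem_left hc z.2, mul_one]
      refine Subgroup.mem_sup_left ?_
      have hn : D.Normal := inferInstance
      rw [commutatorElement_def, mul_assoc, mul_assoc, ← mul_assoc y]
      exact mul_mem hd (hn.conj_mem _ (inv_mem hd) y)
    · obtain ⟨d, hd, z, hz, rfl⟩ := (hK j x).1 hx
      refine (hK (j + 1) _).2 ⟨α d * d⁻¹, mul_mem ?_ (inv_mem hd), _, hR1' j z hz, ?_⟩
      · have := Subgroup.mem_map_of_mem (MulEquiv.toMonoidHom α) hd
        rwa [hDα] at this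
      · have h3 := (restrictAut α _ hcα z * z⁻¹).2
        have h4 : ((restrictAut α _ hcα z * z⁻¹ : commutator N) : N) = α z * (z : N)⁻¹ := rfl
        rw [mul_assoc, ← (commute hc h3 _).eq, h4, map_mul]
        group
    · obtain ⟨y', hy'⟩ := hRJ _ hx
      obtain ⟨y, rfl⟩ := Abelianization.of_surjective y'
      rw [← map_pow, eq_comm, Abelianization.of_eq_of_iff, ← inv_mem_iff, mul_inv_rev,
        inv_inv] at hy'
      have h3 : (y ^ p ^ (k + 1))⁻¹ * x ∈ commutator N := by
        have := (inferInstance : (commutator N).Normal).mem_comm hy'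
        exact this
      refine (hK 0 x).2 ⟨y ^ p ^ (k + 1), ⟨y, 1, one_mem _, by simp⟩, ⟨_, h3⟩, ?_, ?_⟩
      · rw [hR0']; trivial
      · simp
  refine ⟨1 + J + J', (h2 J').trans (Subgroup.map_mono ?_)⟩
  intro x hx
  obtain ⟨d, hd, z, hz, rfl⟩ := (hK J' x).1 hx
  obtain ⟨w, rfl⟩ := hRJ' z hz
  exact mul_mem hd ⟨1, w, w.2, by simp⟩

/-- An element of every `powSubgroup` is infinitely p-divisible modulo N', so lies in N'. Then
y^(p^(k+1)) ∈ N' forces y ∈ N', making the element a p^k-th power inside N' for every k. -/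
theorem isResiduallyNilpotent_cyclicExtension (hc : commutator N ≤ Subgroup.center N) {p : ℕ}
    (hp : p.Prime) (α : MulAut N) (μ : MulAut (Abelianization N)) (hμ : μ ^ p = 1)
    (hα : ∀ x, Abelianization.of (α x) = μ (Abelianization.of x))
    (htf : ∀ (x : N) (n : ℕ), n ≠ 0 → x ^ n ∈ commutator N → x ∈ commutator N)
    (hab : ∀ x : N, (∀ k : ℕ, ∃ y, x * (y ^ p ^ k)⁻¹ ∈ commutator N) → x ∈ commutator N)
    (hcom : ∀ z : N, (∀ k : ℕ, ∃ w ∈ commutator N, z = w ^ p ^ k) → z = 1) :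
    IsResiduallyNilpotent (CyclicExtension α) := by
  refine (Subgroup.eq_bot_iff_forall _).2 fun h hh => ?_
  have hD : ∀ k, h ∈ (powSubgroup hc p k).map (inl : N →* CyclicExtension α) := fun k => by
    obtain ⟨i, hi⟩ := exists_lowerCentralSeries_le hc hp α μ hμ hα k
    exact hi (Subgroup.mem_iInf.1 hh i)
  obtain ⟨x, _, rfl⟩ := hD 0
  have hx : ∀ k, x ∈ powSubgroup hc p k := fun k =>
    (Subgroup.mem_map_iff_mem inl_injective).1 (hD k)
  have hxc : x ∈ commutator N := hab x fun k => by
    obtain ⟨y, z, hz, hy⟩ := hx k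
    refine ⟨y ^ p, ?_⟩
    rw [hy, ← pow_mul, ← pow_succ', ((commute hc hz _).symm.pow_pow _ _).eq, mul_inv_cancel_right]
    exact pow_mem hz _
  rw [hcom x fun k => ?_, map_one]
  obtain ⟨y, z, hz, hy⟩ := hx k
  have hyc : y ∈ commutator N := by
    refine htf y (p ^ (k + 1)) (pow_ne_zero _ hp.ne_zero) ?_
    rw [hy] at hxc
    exact (Subgroup.mul_mem_cancel_right _ (pow_mem hz _)).1 hxc
  refine ⟨y ^ p * z, mul_mem (pow_mem hyc _) hz, ?_⟩
  rw [(commute hc hz _).symm.mul_pow, ← pow_mul, ← pow_succ', hy]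

end ClassTwo

/-! ### Finite generation of M, and powers landing in M -/

/-- Subgroups of finitely generated abelian groups are finitely generated. -/
theorem Subgroup.fg_of_commGroup {L : Type*} [CommGroup L] (hL : Group.FG L) (A : Subgroup L) :
    A.FG := by
  have h1 : Module.Finite ℤ (Additive L) :=
    Module.Finite.iff_addGroup_fg.2 (GroupFG.iff_add_fg.1 hL)
  have h2 := (isNoetherian_def.1 (inferInstance : IsNoetherian ℤ (Additive L)))
    (AddSubgroup.toIntSubmodule (Subgroup.toAddSubgroup A))
  rw [Submodule.fg_iff_addSubgroup_fg] at h2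
  exact (Subgroup.fg_iff_add_fg A).2 h2

theorem Nat.exists_mul_eq_one_add_mul {e P : ℕ} (h : e.Coprime P) (hP : 1 < P) :
    ∃ u j, e * u = 1 + P * j := by
  obtain ⟨u, hu⟩ := Nat.exists_mul_mod_eq_one_of_coprime h hP
  refine ⟨u, e * u / P, ?_⟩
  have := Nat.div_add_mod (e * u) P
  omega

namespace ClassTwo

variable {N : Type u} [Group N]

/-- A subgroup `M` of a group of class at most two with `M ∩ N' = M'` is finitely generated as
soon as its image in the abelianization is. -/
theorem fg_of_map_fg (hc : commutator N ≤ Subgroup.center N) {M : Subgroup N}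
    (hM : M ⊓ commutator N = ⁅M, M⁆) (hA : (M.map Abelianization.of).FG) : M.FG := by
  obtain ⟨S, hS⟩ := hA
  have hSM : (S : Set (Abelianization N)) ⊆ Abelianization.of '' (M : Set N) := by
    have h1 := Subgroup.subset_closure (k := (S : Set (Abelianization N)))
    rw [hS] at h1
    exact h1
  classical
  obtain ⟨S', hS', rfl⟩ := Finset.subset_set_image_iff.1 hSM
  refine ⟨S', le_antisymm ((Subgroup.closure_le M).2 hS') ?_⟩
  set K := Subgroup.closure (S' : Set N)
  have hK : K.map Abelianization.of = M.map Abelianization.of := by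
    rw [MonoidHom.map_closure, ← hS, Finset.coe_image]
  have hex : ∀ x ∈ M, ∃ y ∈ K, x * y⁻¹ ∈ commutator N := fun x hx => by
    have h1 := Subgroup.mem_map_of_mem Abelianization.of hx
    rw [← hK] at h1
    obtain ⟨y, hy, hyx⟩ := h1
    exact ⟨y, hy, Abelianization.of_eq_of_iff.1 hyx.symm⟩
  -- Since M ≤ K N', class two gives M' ≤ K'. Whatever K misses of M lies in M ∩ N' = M', hence in K
  -- after all.
  have hle : ⁅M, M⁆ ≤ K := by
    refine (commutator_le_commutator_of_le_sup hc fun x hx => ?_).trans K.commutator_le_self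
    obtain ⟨y, hy, hyx⟩ := hex x hx
    rw [Subgroup.mem_sup_of_normal_right]
    refine ⟨y, hy, y⁻¹ * x, (inferInstance : (commutator N).Normal).mem_comm hyx, by simp⟩
  intro x hx
  obtain ⟨y, hy, hyx⟩ := hex x hx
  have hyM : y ∈ M := (Subgroup.closure_le M).2 hS' hy
  have h1 : x * y⁻¹ ∈ M ⊓ commutator N := ⟨M.mul_mem hx (M.inv_mem hyM), hyx⟩
  rw [hM] at h1
  simpa using mul_mem (hle h1) hy

section PowMem

variable {M : Subgroup N} {m : ℕ}

/-- Bilinearity turns the power into [x^m, y^m], and x^m, y^m ∈ M N'. -/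
theorem commutatorElement_pow_mem (hc : commutator N ≤ Subgroup.center N)
    (hm : ∀ x : N, Abelianization.of x ^ m ∈ M.map Abelianization.of) (x y : N) :
    ⁅x, y⁆ ^ (m * m) ∈ M := by
  have h : ∀ x : N, x ^ m ∈ M ⊔ commutator N := fun x => by
    obtain ⟨y, hy, hyx⟩ := hm x
    rw [← map_pow, eq_comm, Abelianization.of_eq_of_iff] at hyx
    rw [Subgroup.mem_sup_of_normal_right]
    exact ⟨y, hy, y⁻¹ * x ^ m, (inferInstance : (commutator N).Normal).mem_comm hyx, by simp⟩
  rw [← commutatorElement_pow_pow hc]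
  exact M.commutator_le_self (commutator_le_commutator_of_le_sup hc le_rfl
    (Subgroup.commutator_mem_commutator (h x) (h y)))

theorem pow_mem_of_mem_commutator (hc : commutator N ≤ Subgroup.center N)
    (hm : ∀ x : N, Abelianization.of x ^ m ∈ M.map Abelianization.of) {z : N}
    (hz : z ∈ commutator N) : z ^ (m * m) ∈ M := by
  let K : Subgroup N :=
    { carrier := {z | z ∈ commutator N ∧ z ^ (m * m) ∈ M}
      one_mem' := ⟨one_mem _, by simp⟩
      mul_mem' := fun {a b} ha hb => ⟨mul_mem ha.1 hb.1, by
        rw [(commute hc ha.1 b).mul_pow]; exact mul_mem ha.2 hb.2⟩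
      inv_mem' := fun {a} ha => ⟨inv_mem ha.1, by rw [inv_pow]; exact inv_mem ha.2⟩ }
  have hK : commutator N ≤ K := by
    rw [commutator_def, Subgroup.commutator_le]
    exact fun x _ y _ => ⟨commutator_mem x y, commutatorElement_pow_mem hc hm x y⟩
  exact (hK hz).2

/-- Write x^m = cy with c ∈ N' central and y ∈ M; a further power m² brings c into M. -/
theorem pow_mem (hc : commutator N ≤ Subgroup.center N)
    (hm : ∀ x : N, Abelianization.of x ^ m ∈ M.map Abelianization.of) (x : N) :
    x ^ (m * (m * m)) ∈ M := by
  obtain ⟨y, hy, hyx⟩ := hm x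
  rw [← map_pow, eq_comm, Abelianization.of_eq_of_iff] at hyx
  have h1 : x ^ m = x ^ m * y⁻¹ * y := by group
  rw [pow_mul, h1, (commute hc hyx y).mul_pow]
  exact mul_mem (pow_mem_of_mem_commutator hc hm hyx) (Subgroup.pow_mem _ hy _)

end PowMem

/-! ### Comparing the lower central quotients of G and H -/

section Para

variable {α : MulAut N} {M : Subgroup N} {hM : M.map (MulEquiv.toMonoidHom α) = M} {p m : ℕ}

/-- The inclusion `M ⋊ T → N ⋊ T`. -/
def inclusionHom (α : MulAut N) (M : Subgroup N) (hM : M.map (MulEquiv.toMonoidHom α) = M) :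
    CyclicExtension (restrictAut α M hM) →* CyclicExtension α :=
  CyclicExtension.mapHom M.subtype (coe_restrictAut α M hM)

theorem inclusionHom_inl (x : M) : inclusionHom α M hM (inl x) = inl (x : N) :=
  CyclicExtension.mapHom_inl _ _ _

theorem inclusionHom_gen :
    inclusionHom α M hM (CyclicExtension.gen _) = CyclicExtension.gen α :=
  CyclicExtension.mapHom_gen _ _

theorem inclusionHom_injective : Function.Injective (inclusionHom α M hM) :=
  CyclicExtension.mapHom_injective _ Subtype.val_injective

/-- With n = m³u ≡ 1 modulo p^(i+1), xⁿ lies in M and agrees with x modulo a term containing all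
p^i-th powers of N. -/
theorem lowerCentralQuotientMap_inclusion_surjective (hc : commutator N ≤ Subgroup.center N)
    (hp : p.Prime) (hmp : m.Coprime p)
    (hm : ∀ x : N, Abelianization.of x ^ m ∈ M.map Abelianization.of)
    (hα : ∀ x, (inl x : CyclicExtension α) ^ p ∈ commutator (CyclicExtension α)) (i : ℕ) :
    Function.Surjective (lowerCentralQuotientMap (inclusionHom α M hM) i) := by
  have hco : (m * (m * m)).Coprime (p ^ (i + 1)) :=
    Nat.Coprime.pow_right _ (hmp.mul_left (hmp.mul_left hmp))
  obtain ⟨u, j, huj⟩ := Nat.exists_mul_eq_one_add_mul hco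
    (Nat.one_lt_pow i.succ_ne_zero hp.one_lt)
  let S : Subgroup (CyclicExtension α) :=
    (lowerCentralQuotientMap (inclusionHom α M hM) i).range.comap (QuotientGroup.mk' _)
  have hS : S = ⊤ := by
    refine CyclicExtension.eq_top_of_le (fun x => ?_)
      ⟨QuotientGroup.mk (CyclicExtension.gen _), ?_⟩
    · have hx : x ^ (m * (m * m) * u) ∈ M := by
        rw [pow_mul]; exact Subgroup.pow_mem _ (pow_mem hc hm x) _
      refine ⟨QuotientGroup.mk (inl ⟨_, hx⟩), ?_⟩
      change QuotientGroup.mk (inclusionHom α M hM (inl _)) = QuotientGroup.mk _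
      rw [inclusionHom_inl, map_pow, eq_comm, QuotientGroup.eq,
        huj, pow_add, pow_one, inv_mul_cancel_left, pow_succ, mul_assoc, pow_mul]
      exact Subgroup.pow_mem _ (CyclicExtension.inl_pow_mem_lowerCentralSeries hα x i) _
    · exact congrArg QuotientGroup.mk inclusionHom_gen
  intro b
  obtain ⟨h, rfl⟩ := QuotientGroup.mk_surjective b
  have hh : h ∈ S := by rw [hS]; trivial
  exact hh

/-- If `m` is prime to `p` and `N^m ≤ M N'`, a homomorphism from `M` to a group in which it has
exponent `p^i` extends to `N`, through a power map. -/
theorem exists_extension (hc : commutator N ≤ Subgroup.center N) (hp : p.Prime)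
    (hmp : m.Coprime p) (hm2 : Even (m * p))
    (hm : ∀ x : N, Abelianization.of x ^ m ∈ M.map Abelianization.of) {Q : Type*} [Group Q]
    (q : M →* Q) {i : ℕ} (hq : ∀ x, q x ^ p ^ i = 1) :
    ∃ (n : ℕ) (hn : ∀ x : N, x ^ n ∈ M) (f : N →* Q),
      (∀ x, f x = q ⟨x ^ n, hn x⟩) ∧ ∀ x : M, f x = q x := by
  have hco : (m * (m * m)).Coprime (p ^ (i + 1)) :=
    Nat.Coprime.pow_right _ (hmp.mul_left (hmp.mul_left hmp))
  obtain ⟨u, j, huj⟩ := Nat.exists_mul_eq_one_add_mul hco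
    (Nat.one_lt_pow i.succ_ne_zero hp.one_lt)
  obtain ⟨n, hn'⟩ : ∃ n, n = m * (m * m) * u := ⟨_, rfl⟩
  have hn : ∀ x : N, x ^ n ∈ M := fun x => by
    rw [hn', pow_mul]; exact Subgroup.pow_mem _ (pow_mem hc hm x) _
  obtain ⟨w, hw⟩ := hm2
  -- The modulus p^(i+1) instead of p^i leaves a spare p; with a spare m it makes the even number
  -- mp, which absorbs the division by 2.
  have hchoose : n.choose 2 = m * m * (p ^ i * (w * u * j)) := by
    rw [Nat.choose_two_right]
    refine Nat.div_eq_of_eq_mul_right two_pos ?_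
    have h1 : n - 1 = p ^ (i + 1) * j := by omega
    rw [h1, hn', pow_succ]
    calc m * (m * m) * u * (p ^ i * p * j) = m * m * u * p ^ i * j * (m * p) := by ring
      _ = _ := by rw [hw]; ring
  -- The correction term is a p^i-th power of an element of M, so q kills it.
  have hmul : ∀ x y : N, q ⟨(x * y) ^ n, hn _⟩ = q ⟨x ^ n, hn _⟩ * q ⟨y ^ n, hn _⟩ := fun x y => by
    have h1 : (⟨(x * y) ^ n, hn _⟩ : M) = ⟨x ^ n, hn _⟩ * ⟨y ^ n, hn _⟩ *
        (⟨⁅y, x⁆ ^ (m * m), commutatorElement_pow_mem hc hm y x⟩ ^ p ^ i) ^ (w * u * j) := by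
      refine Subtype.ext ?_
      change (x * y) ^ n = x ^ n * y ^ n * ((⁅y, x⁆ ^ (m * m)) ^ p ^ i) ^ (w * u * j)
      rw [mul_pow_eq hc, hchoose, pow_mul, pow_mul]
    rw [h1, map_mul, map_mul, map_pow, map_pow, hq, one_pow, mul_one]
  refine ⟨n, hn, MonoidHom.mk' _ hmul, fun _ => rfl, fun x => ?_⟩
  have h1 : (⟨(x : N) ^ n, hn x⟩ : M) = x * (x ^ p ^ i) ^ (p * j) := by
    refine Subtype.ext ?_
    change (x : N) ^ n = x * ((x : N) ^ p ^ i) ^ (p * j)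
    rw [hn', huj, pow_add, pow_one, pow_succ, mul_assoc, pow_mul]
  change q ⟨(x : N) ^ n, hn x⟩ = q x
  rw [h1, map_mul, map_pow, map_pow, hq, one_pow, mul_one]

/-- The quotient map q of G extends to F on H. The target has trivial i-th lower central term, so F
kills that of H, and an element of G lying there is killed by q. -/
theorem lowerCentralQuotientMap_inclusion_injective (hc : commutator N ≤ Subgroup.center N)
    (hp : p.Prime) (hmp : m.Coprime p) (hm2 : Even (m * p))
    (hm : ∀ x : N, Abelianization.of x ^ m ∈ M.map Abelianization.of)
    (hβ : ∀ x, (inl x : CyclicExtension (restrictAut α M hM)) ^ p ∈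
      commutator (CyclicExtension (restrictAut α M hM))) (i : ℕ) :
    Function.Injective (lowerCentralQuotientMap (inclusionHom α M hM) i) := by
  let q := QuotientGroup.mk'
    ((⊤ : Subgroup (CyclicExtension (restrictAut α M hM))).lowerCentralSeries i)
  obtain ⟨n, hn, f, hf, hfM⟩ := exists_extension hc hp hmp hm2 hm (q.comp inl) (i := i)
    fun x => by
      rw [MonoidHom.comp_apply, ← map_pow]
      exact (QuotientGroup.eq_one_iff _).2 (CyclicExtension.inl_pow_mem_lowerCentralSeries hβ x i)
  -- Power maps commute with α, so f is equivariant and extends over t.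
  have hequiv : ∀ x, f (α x) = q (CyclicExtension.gen _) * f x * (q (CyclicExtension.gen _))⁻¹ := by
    intro x
    have h1 : (⟨(α x) ^ n, hn _⟩ : M) = restrictAut α M hM ⟨x ^ n, hn x⟩ := by
      refine Subtype.ext ?_
      rw [coe_restrictAut, map_pow]
    rw [hf, hf, h1, MonoidHom.comp_apply, MonoidHom.comp_apply, CyclicExtension.inl_apply, map_mul,
      map_mul, map_inv]
  let F := CyclicExtension.liftHom f _ hequiv
  have hF : (F.comp (inclusionHom α M hM)).eqLocus q = ⊤ := by
    refine CyclicExtension.eq_top_of_le (fun x => ?_) ?_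
    · change F (inclusionHom α M hM (inl x)) = q (inl x)
      rw [inclusionHom_inl, CyclicExtension.liftHom_inl]
      exact hfM x
    · change F (inclusionHom α M hM (CyclicExtension.gen _)) = q _
      rw [inclusionHom_gen, CyclicExtension.liftHom_gen]
  rw [injective_iff_map_eq_one]
  intro a ha
  obtain ⟨g, rfl⟩ := QuotientGroup.mk_surjective a
  have h1 : inclusionHom α M hM g ∈ (⊤ : Subgroup (CyclicExtension α)).lowerCentralSeries i :=
    (QuotientGroup.eq_one_iff _).1 ha
  have h2 := lowerCentralSeries_le_comap_hom F i h1
  have h3 : F (inclusionHom α M hM g) = q g := by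
    have : g ∈ (F.comp (inclusionHom α M hM)).eqLocus q := by rw [hF]; trivial
    exact this
  rw [Subgroup.mem_comap, h3] at h2
  have h4 : (⊤ : Subgroup (CyclicExtension (restrictAut α M hM) ⧸
      (⊤ : Subgroup (CyclicExtension (restrictAut α M hM))).lowerCentralSeries i)).lowerCentralSeries
        i = ⊥ := by
    have h5 := Subgroup.map_lowerCentralSeries (⊤ : Subgroup _) q i
    rw [QuotientGroup.map_mk'_self, ← MonoidHom.range_eq_map,
      MonoidHom.range_eq_top.2 (QuotientGroup.mk'_surjective _)] at h5
    exact h5.symm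
  rw [h4] at h2
  exact h2

end Para

end ClassTwo

/-! ### The theorem -/

theorem IsResiduallyNilpotent.of_injective {G : Type u} {H : Type v} [Group G] [Group H]
    (φ : G →* H) (hφ : Function.Injective φ) (hH : IsResiduallyNilpotent H) :
    IsResiduallyNilpotent G := by
  refine (Subgroup.eq_bot_iff_forall _).2 fun g hg => hφ ?_
  rw [map_one]
  refine (Subgroup.eq_bot_iff_forall _).1 hH _ (Subgroup.mem_iInf.2 fun i => ?_)
  exact lowerCentralSeries_le_comap_hom φ i (Subgroup.mem_iInf.1 hg i)

theorem theorem3p8 {N : Type u} [Group N] (hN : IsFGFreeNilpotentTwo N)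
    {p : ℕ} (hp : p.Prime)
    (μ : MulAut (Abelianization N)) (hμ_order : orderOf μ = p)
    (hμ_fpf : ∀ x : Abelianization N, μ x = x → x = 1)
    (hμ_gen : ∃ a : Abelianization N,
      Subgroup.closure {y : Abelianization N | ∃ i : ℕ, i ≤ p - 2 ∧ y = (μ ^ i) a} = ⊤) :
    (∃ α : MulAut N, ∀ x : N, Abelianization.of (α x) = μ (Abelianization.of x)) ∧
    ∀ α : MulAut N, (∀ x : N, Abelianization.of (α x) = μ (Abelianization.of x)) →
      ∀ (A : Subgroup (Abelianization N)) (hA : A.map (MulEquiv.toMonoidHom μ) = A),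
        (∃ m : ℕ, m.Coprime p ∧ ∀ x : Abelianization N, x ^ m ∈ A) →
      ∀ (M : Subgroup N) (hM : M.map (MulEquiv.toMonoidHom α) = M),
        M ⊓ commutator N = ⁅M, M⁆ → M.map Abelianization.of = A →
        IsPara (CyclicExtension (restrictAut α M hM)) (CyclicExtension α) ∧
        (IsEmpty (CyclicExtension (restrictAut μ A hA) ≃* CyclicExtension μ) →
          IsEmpty (CyclicExtension (restrictAut α M hM) ≃* CyclicExtension α)) := by
  obtain ⟨r, ⟨e⟩⟩ := hN
  have hμ : μ ^ p = 1 := hμ_order ▸ pow_orderOf_eq_one μ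
  refine ⟨FreeNilpotentTwo.exists_lift_aut e μ, fun α hα A hA hm M hM hMc hMA => ?_⟩
  subst hMA
  have hc := FreeNilpotentTwo.commutator_le_center e
  have hNfg := FreeNilpotentTwo.fg e
  -- M ∩ N' = M' enters here: the kernel of M → N/N' is exactly M', so M/M' is A.
  have hker : ∀ x : M, Abelianization.of (x : N) = 1 ↔ x ∈ commutator M := fun x => by
    rw [Abelianization.of_eq_one_iff, ← Subgroup.mem_map_iff_mem M.subtype_injective,
      Subgroup.map_subtype_commutator, ← hMc]
    exact ⟨fun h => ⟨x.2, h⟩, fun h => h.2⟩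
  have hαp : ∀ x, (inl x : CyclicExtension α) ^ p ∈ commutator (CyclicExtension α) :=
    CyclicExtension.inl_pow_mem_commutator hμ hμ_fpf Abelianization.of hα
      (Abelianization.ker_of N).le
  have hβp : ∀ x, (inl x : CyclicExtension (restrictAut α M hM)) ^ p ∈
      commutator (CyclicExtension (restrictAut α M hM)) :=
    CyclicExtension.inl_pow_mem_commutator hμ hμ_fpf (Abelianization.of.comp M.subtype)
      (fun x => hα x) fun x hx => (hker x).1 hx
  -- For odd p, replacing m by 2m keeps it prime to p and makes mp even; for p = 2 it is even
  -- already.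
  obtain ⟨m, hmp, hm2, hm⟩ : ∃ m : ℕ, m.Coprime p ∧ Even (m * p) ∧
      ∀ x : N, Abelianization.of x ^ m ∈ M.map Abelianization.of := by
    obtain ⟨m, hmp, hm⟩ := hm
    rcases hp.eq_two_or_odd' with rfl | hodd
    · exact ⟨m, hmp, even_two.mul_left m, fun x => hm _⟩
    · refine ⟨2 * m, Nat.Coprime.mul_left (Nat.coprime_two_left.2 hodd) hmp,
        (even_two_mul m).mul_right p, fun x => ?_⟩
      rw [mul_comm, pow_mul]
      exact pow_mem (hm _) 2
  have hHres : IsResiduallyNilpotent (CyclicExtension α) :=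
    ClassTwo.isResiduallyNilpotent_cyclicExtension hc hp α μ hμ hα
      (fun _ _ => FreeNilpotentTwo.mem_commutator_of_pow_mem e)
      (fun _ => FreeNilpotentTwo.mem_commutator_of_forall_pow e hp.two_le)
      (fun _ => FreeNilpotentTwo.eq_one_of_mem_commutator_of_forall_pow e hp.two_le)
  have hMfg : Group.FG M := (Group.fg_iff_subgroup_fg M).2
    (ClassTwo.fg_of_map_fg hc hMc (Subgroup.fg_of_commGroup (QuotientGroup.fg _) _))
  refine ⟨⟨⟨CyclicExtension.fg hMfg,
    hHres.of_injective _ ClassTwo.inclusionHom_injective⟩, ⟨CyclicExtension.fg hNfg, hHres⟩,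
    ClassTwo.inclusionHom α M hM, ClassTwo.inclusionHom_injective, fun i =>
      ⟨ClassTwo.lowerCentralQuotientMap_inclusion_injective hc hp hmp hm2 hm hβp i,
        ClassTwo.lowerCentralQuotientMap_inclusion_surjective hc hp hmp hm hαp i⟩⟩,
    fun hempty => ⟨fun θ => ?_⟩⟩
  let f : M →* M.map Abelianization.of := Abelianization.of.subgroupMap M
  obtain ⟨ε⟩ := CyclicExtension.nonempty_mulEquiv_of_mulEquiv hp.ne_zero hβp hαp
    (μ := restrictAut μ _ hA) (ν := μ) f (fun x => Subtype.ext (hα x))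
    (Abelianization.of.subgroupMap_surjective M)
    (by
      ext x
      rw [← hker, MonoidHom.mem_ker, Subtype.ext_iff]
      rfl)
    Abelianization.of hα Abelianization.of_surjective (Abelianization.ker_of N) θ
  exact hempty.false ε
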